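/- Let $\mathbb K$ be a field of characteristic zero, let $\mathcal O$ be a commutative unital $\mathbb K$-algebra, and let $\mathrm{Der}(\mathcal O)$ be the Lie algebra of $\mathbb K$-linear derivations of $\mathcal O$. A *Lie–Rinehart algebra* over $\mathcal O$ is an $\mathcal O$-module $\mathcal A$ with a Lie $\mathbb K$-algebra bracket $[\cdot,\cdot]_{\mathcal A}$ and an $\mathcal O$-linear Lie algebra morphism $\rho_{\mathcal A}\colon \mathcal A\to \mathrm{Der}(\mathcal O)$ (the anchor) such that $[a,fb]_{\mathcal A}=\rho_{\mathcal A}(a)[f]\,b+f[a,b]_{\mathcal A}$ for all $a,b\in\mathcal A$, $f\in\mathcal O$. A (negatively graded) *Lie $\infty$-algebroid* over $\mathcal O$ is a family $\mathcal E=(\mathcal E_i)_{i\le -1}$ of projective $\mathcal O$-modules with graded symmetric $\mathbb K$-multilinear maps $\ell_k$ of $k$ arguments in $\mathcal E$, with values in $\mathcal E$ and of degree $+1$ ($k\ge 1$), and an $\mathcal O$-linear map $\rho_{\mathcal E}\colon\mathcal E_{-1}\to\mathrm{Der}(\mathcal O)$, such that 1. for all $n\ge1$ and homogeneous $x_1,\dots,x_n\in\mathcal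 E$, $$\sum_{i=1}^n\sum_{\sigma}\epsilon(\sigma)\,\ell_{n-i+1}\bigl(\ell_i(x_{\sigma(1)},\dots,x_{\sigma(i)}),x_{\sigma(i+1)},\dots,x_{\sigma(n)}\bigr)=0,$$ where $\sigma$ runs over the $(i,n-i)$-shuffles and $\epsilon(\sigma)$ is the Koszul sign; 2. $\ell_k$ is $\mathcal O$-multilinear for $k\neq2$, and $\ell_2(x,fy)=\rho_{\mathcal E}(x)[f]\,y+f\,\ell_2(x,y)$ for all $x,y\in\mathcal E$, $f\in\mathcal O$, where $\rho_{\mathcal E}$ is extended by zero to $\mathcal E_{i}$, $i\le-2$; 3. $\rho_{\mathcal E}\circ\ell_1=0$ on $\mathcal E_{-2}$; 4. $\rho_{\mathcal E}(\ell_2(x,y))=[\rho_{\mathcal E}(x),\rho_{\mathcal E}(y)]$ for all $x,y\in\mathcal E_{-1}$. It *terminates* in $\mathcal A$ through the hook $\pi$, where $\pi\colon\mathcal E_{-1}\to\mathcal A$ is an $\mathcal O$-linear map, if $\rho_{\mathcal A}\circ\pi=\rho_{\mathcal E}$ and $[\pi(x),\pi(y)]_{\mathcal A}=\pi(\ell_2(x,y))$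 for all $x,y\in\mathcal E_{-1}$. It is *universal* for $\mathcal A$ through $\pi$ if moreover $\cdots\xrightarrow{\ell_1}\mathcal E_{-2}\xrightarrow{\ell_1}\mathcal E_{-1}\xrightarrow{\pi}\mathcal A\to0$ is exact, i.e. a projective resolution of the $\mathcal O$-module $\mathcal A$. **Theorem.** Let $\mathcal A$ be a Lie–Rinehart algebra over $\mathcal O$. (a) Let $\cdots\xrightarrow{\ell_1}\mathcal E_{-3}\xrightarrow{\ell_1}\mathcal E_{-2}\xrightarrow{\ell_1}\mathcal E_{-1}\xrightarrow{\pi}\mathcal A\to0$ be any resolution of $\mathcal A$ by free $\mathcal O$-modules, possibly of infinite length and of infinite rank in every degree. Then $\mathcal E=(\mathcal E_i)_{i\le-1}$ carries a Lie $\infty$-algebroid structure over $\mathcal O$ whose unary bracket is $\ell_1$ and which terminates in $\mathcal A$ through the hook $\pi$. (b) Consequently, every Lie–Rinehart algebra $\mathcal A$ over $\mathcal O$ admits a universal Lie $\infty$-algebroid. -/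

import Mathlib

/-!
# Lie ∞-algebroids over a commutative algebra

A negatively graded family of modules `(𝓔_i)_{i ≤ -1}` is encoded as a family `E : ℕ → Type*`,
the module `E n` sitting in degree `-(n + 1)`: `E 0 = 𝓔_{-1}`, `E 1 = 𝓔_{-2}`, and so on.
The graded module itself is the direct sum `⨁ n, E n`.
-/

universe uK uO uA uE

open scoped DirectSum

namespace LieInfty

/-- The degree `-(n + 1)` of the elements of `E n`. -/
def deg (n : ℕ) : ℤ := -((n : ℤ) + 1)

/-- The Koszul sign `ε(σ; x₁, …, x_k)` of a permutation `σ` and of homogeneous elements `x_i` of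
degree `d i`, i.e. the sign such that `x_{σ 1} ⊙ ⋯ ⊙ x_{σ k} = ε(σ; x) x₁ ⊙ ⋯ ⊙ x_k` in the graded
symmetric algebra: each pair of positions that `σ` inverts contributes
`(-1) ^ (product of the two degrees)`. -/
def koszulSign {k : ℕ} (d : Fin k → ℤ) (σ : Equiv.Perm (Fin k)) : ℤˣ :=
  ∏ p : Fin k × Fin k with p.1 < p.2 ∧ σ p.2 < σ p.1, Int.negOnePow (d (σ p.1) * d (σ p.2))

/-- The `(p, n - p)`-shuffles: permutations of `n` letters that are increasing on the first `p`
positions and increasing on the remaining ones. -/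
def shuffles (n p : ℕ) : Finset (Equiv.Perm (Fin n)) :=
  {σ | (∀ a b : Fin n, a < b → b.val < p → σ a < σ b) ∧
       (∀ a b : Fin n, a < b → p ≤ a.val → σ a < σ b)}

variable (K : Type*) (O : Type*) [Field K] [CommRing O] [Algebra K O]

/-- A (negatively graded) Lie ∞-algebroid structure over the commutative `K`-algebra `O` on the
graded `O`-module with component `E n` in degree `-(n + 1)`. -/
structure LieInftyAlgebroid (E : ℕ → Type*) [∀ n, AddCommGroup (E n)] [∀ n, Module O (E n)]
    [∀ n, Module K (E n)] [∀ n, IsScalarTower K O (E n)] where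
  /-- every component is a projective `O`-module -/
  projective : ∀ n, Module.Projective O (E n)
  /-- `bracket k` is the `(k + 1)`-ary bracket `ℓ_{k + 1}`, a `K`-multilinear map -/
  bracket : ∀ k : ℕ, MultilinearMap K (fun _ : Fin (k + 1) => ⨁ n, E n) (⨁ n, E n)
  /-- the anchor `𝓔_{-1} → Der(O)`, an `O`-linear map -/
  anchor : E 0 →ₗ[O] Derivation K O O
  /-- the brackets are graded symmetric -/
  bracket_symm : ∀ (k : ℕ) (d : Fin (k + 1) → ℕ) (x : ∀ i, E (d i)) (σ : Equiv.Perm (Fin (k + 1))),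
    bracket k (fun i => DirectSum.of E (d (σ i)) (x (σ i))) =
      koszulSign (fun i => deg (d i)) σ • bracket k (fun i => DirectSum.of E (d i) (x i))
  /-- the brackets have degree `+1`: on homogeneous arguments, every component of the value
  outside degree `|x₁| + ⋯ + |x_{k+1}| + 1` is zero -/
  bracket_degree : ∀ (k : ℕ) (d : Fin (k + 1) → ℕ) (x : ∀ i, E (d i)) (m : ℕ),
    deg m ≠ ∑ i, deg (d i) + 1 → bracket k (fun i => DirectSum.of E (d i) (x i)) m = 0
  /-- the higher Jacobi identity for `n + 1` homogeneous elements: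
  `∑ ε(σ) ℓ_{n-i+1} (ℓ_{i+1} (x_{σ 1}, …, x_{σ (i+1)}), x_{σ (i+2)}, …, x_{σ (n+1)}) = 0`, the sum
  being over `0 ≤ i ≤ n` and over the `(i + 1, n - i)`-shuffles `σ` -/
  jacobi : ∀ (n : ℕ) (d : Fin (n + 1) → ℕ) (x : ∀ i, E (d i)),
    ∑ i : Fin (n + 1), ∑ σ ∈ shuffles (n + 1) (i.val + 1),
      koszulSign (fun j => deg (d j)) σ •
        bracket (n - i.val) (Fin.cons
          (bracket i.val fun j : Fin (i.val + 1) =>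
            DirectSum.of E (d (σ ⟨j.val, by omega⟩)) (x (σ ⟨j.val, by omega⟩)))
          (fun j : Fin (n - i.val) =>
            DirectSum.of E (d (σ ⟨i.val + 1 + j.val, by omega⟩))
              (x (σ ⟨i.val + 1 + j.val, by omega⟩)))) = 0
  /-- all brackets but the binary one are `O`-linear in each argument -/
  bracket_smul : ∀ k : ℕ, k ≠ 1 → ∀ (x : Fin (k + 1) → ⨁ n, E n) (i : Fin (k + 1)) (f : O),
    bracket k (Function.update x i (f • x i)) = f • bracket k x
  /-- the Leibniz identity of the binary bracket, where the anchor is extended by zero to the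
  components of degree `≤ -2` -/
  leibniz : ∀ (x y : ⨁ n, E n) (f : O),
    bracket 1 ![x, f • y] = anchor (x 0) f • y + f • bracket 1 ![x, y]
  /-- `ρ ∘ ℓ₁ = 0` on `𝓔_{-2}` -/
  anchor_unary : ∀ x : E 1, anchor (bracket 0 ![DirectSum.of E 1 x] 0) = 0
  /-- `ρ (ℓ₂ (x, y)) = [ρ x, ρ y]` on `𝓔_{-1}` -/
  anchor_binary : ∀ x y : E 0,
    anchor (bracket 1 ![DirectSum.of E 0 x, DirectSum.of E 0 y] 0) = ⁅anchor x, anchor y⁆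

section

variable {O} {E : ℕ → Type*} [∀ n, AddCommGroup (E n)] [∀ n, Module O (E n)]

/-- The sequence `⋯ → E 2 → E 1 → E 0 → A → 0` of `O`-modules is exact. -/
structure IsResolution {A : Type*} [AddCommGroup A] [Module O A]
    (d : ∀ n, E (n + 1) →ₗ[O] E n) (π : E 0 →ₗ[O] A) : Prop where
  surjective : Function.Surjective π
  exact_zero : Function.Exact (d 0) π
  exact_succ : ∀ n, Function.Exact (d (n + 1)) (d n)

variable {K} [∀ n, Module K (E n)] [∀ n, IsScalarTower K O (E n)]

namespace LieInftyAlgebroid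

variable (L : LieInftyAlgebroid K O E)

/-- The component `E (n + 1) → E n` of the unary bracket `ℓ₁`. -/
def unary (n : ℕ) : E (n + 1) →ₗ[O] E n where
  toFun x := L.bracket 0 ![DirectSum.of E (n + 1) x] n
  map_add' x y := by
    have h := (L.bracket 0).map_update_add ![0] 0
      (DirectSum.of E (n + 1) x) (DirectSum.of E (n + 1) y)
    have e : ∀ z : ⨁ n, E n, Function.update (![0] : Fin 1 → ⨁ n, E n) 0 z = ![z] := by
      intro z
      ext i
      fin_cases i
      simp
    simp only [Nat.reduceAdd, Fin.isValue] at h e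
    rw [e, e, e] at h
    rw [map_add, h, DirectSum.add_apply]
  map_smul' f x := by
    have h := L.bracket_smul 0 (by decide) ![DirectSum.of E (n + 1) x] 0 f
    have e : ∀ y z : ⨁ n, E n, Function.update (![y] : Fin 1 → ⨁ n, E n) 0 z = ![z] := by
      intro y z
      ext i
      fin_cases i
      simp
    simp only [Nat.reduceAdd, Fin.isValue, Matrix.cons_val_fin_one] at h e
    rw [e, ← DirectSum.of_smul] at h
    rw [h, DirectSum.smul_apply, RingHom.id_apply]

variable {A : Type*} [LieRing A] [Module O A] [LieRingModule A O] [LieRinehartRing O A]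
  [LieAlgebra K A] [LieRinehartAlgebra K O A]

/-- The Lie ∞-algebroid `L` terminates at the Lie-Rinehart algebra `A` through the hook
`π : 𝓔_{-1} → A`. -/
structure TerminatesAt (π : E 0 →ₗ[O] A) : Prop where
  anchor_hook : ∀ x : E 0, LieRinehartAlgebra.anchor K O A (π x) = L.anchor x
  bracket_hook : ∀ x y : E 0,
    ⁅π x, π y⁆ = π (L.bracket 1 ![DirectSum.of E 0 x, DirectSum.of E 0 y] 0)

/-- The Lie ∞-algebroid `L` is universal for the Lie-Rinehart algebra `A` through the hook `π`:
it terminates at `A` through `π`, and `⋯ → 𝓔_{-2} → 𝓔_{-1} → A → 0`, with the unary bracket as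
differential, is a resolution of `A` (by projective modules, as part of `L`). -/
structure IsUniversalFor (π : E 0 →ₗ[O] A) : Prop extends L.TerminatesAt π where
  resolution : IsResolution L.unary π

end LieInftyAlgebroid

end

end LieInfty

/-!
The total module `V = ⨁ n, E n` of a free resolution has a basis of homogeneous vectors, so brackets
on `V` are given by structure constants: a function `c` of words in the basis vectors, extended
`O`-multilinearly. In arity two one adds the derivative terms of the Leibniz rule, which are the
covariant derivatives, along the hook of one argument, of the other argument for the flat connection
whose horizontal sections are the basis vectors (`GradedResolution.flat`,
`GradedResolution.derivPart`). For every choice of `c`, the resulting brackets obey the Leibniz rule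
and the linearity requirements; what has to be achieved is the vanishing of the Jacobiator `J`, the
left-hand side of the higher Jacobi identities.

Although the binary bracket is not `O`-bilinear, `J` is `O`-multilinear
(`GradedResolution.Admissible.jacobiator_smul_cons`): the terms with first derivatives cancel in
pairs, and those with second derivatives because the anchor preserves brackets. Hence `J` vanishes
as soon as it vanishes on words in the basis vectors. The structure constants on pairs of vectors of
degree `-1` are chosen as lifts of the bracket of `A` through the hook; the others are found by
induction on the total degree of the word. For a word `w` of total degree `-s`, all terms of `J w`
except `D (c w)` involve only structure constants of words of degree greater than `-s`. If `J`
vanishes in all degrees greater than `-s`, then the Bianchi identity `J ∘ ℓ = ℓ ∘ J`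
(`GradedResolution.Admissible.bianchi`) reduces to `D (J w) = 0`. Moreover the hook kills `J w`, for
words of degree `-3` by the Jacobi identity of `A` and otherwise by degree reasons. By exactness
`J w` is a boundary, so a change of `c w` makes it vanish; in characteristic zero the new constants can
be made graded symmetric by averaging over permutations (`GradedResolution.exists_gradedSymm_lift`).
Since each constant is changed only once, the process converges
(`GradedResolution.exists_jacobiator_eq_zero`).

The computations are done with lists of homogeneous elements and with sums over their unshuffles,
defined by recursion on the list (`unshuffleSum`). Coassociativity and cocommutativity of unshuffles
take the place of manipulations of shuffles. A comparison of Koszul signs identifies these sums with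
sums over shuffles (`sum_shuffles_eq_unshuffleSum`). The second claim follows from the first,
applied to the canonical free resolution (`exists_free_resolution`).
-/

namespace LieInfty

/-! ### Unshuffle sums and graded symmetric functions of lists -/

section Unshuffle

variable {X : Type*} {W : Type*} [AddCommGroup W]

/-- The total degree of a list of homogeneous elements. -/
def totalDeg (dg : X → ℤ) (L : List X) : ℤ := (L.map dg).sum

@[simp] lemma totalDeg_nil (dg : X → ℤ) : totalDeg dg [] = 0 := rfl

@[simp] lemma totalDeg_cons (dg : X → ℤ) (x : X) (L : List X) :
    totalDeg dg (x :: L) = dg x + totalDeg dg L := by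
  simp [totalDeg]

@[simp] lemma totalDeg_append (dg : X → ℤ) (L M : List X) :
    totalDeg dg (L ++ M) = totalDeg dg L + totalDeg dg M := by
  simp [totalDeg]

lemma totalDeg_perm (dg : X → ℤ) {L M : List X} (h : L.Perm M) :
    totalDeg dg L = totalDeg dg M := (h.map dg).sum_eq

lemma sign_congr {a b : ℤ} (v : W) (h : Even (a - b)) : a.negOnePow • v = b.negOnePow • v := by
  rw [(Int.negOnePow_eq_iff a b).2 h]

lemma sign_smul_sign (a b : ℤ) (v : W) :
    a.negOnePow • b.negOnePow • v = (a + b).negOnePow • v := by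
  rw [smul_smul, Int.negOnePow_add]

/-- A function of lists of homogeneous elements is graded symmetric if exchanging two neighbours
costs the Koszul sign. -/
def GradedSymm (dg : X → ℤ) (F : List X → W) : Prop :=
  ∀ (p : List X) (x y : X) (q : List X),
    F (p ++ x :: y :: q) = (dg x * dg y).negOnePow • F (p ++ y :: x :: q)

lemma GradedSymm.cons {dg : X → ℤ} {F : List X → W} (h : GradedSymm dg F) (a : X) :
    GradedSymm dg (fun L => F (a :: L)) := fun p x y q => h (a :: p) x y q

/-- Moving a letter to the front costs the Koszul sign of exchanging it with its predecessors. -/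
lemma GradedSymm.move {dg : X → ℤ} {F : List X → W} (h : GradedSymm dg F) (p : List X) (x : X)
    (q : List X) :
    F (p ++ x :: q) = (totalDeg dg p * dg x).negOnePow • F (x :: (p ++ q)) := by
  induction p generalizing F with
  | nil => simp
  | cons a p ih =>
    have h' := h [] a x (p ++ q)
    simp only [List.nil_append] at h'
    rw [List.cons_append, ih (h.cons a), h', sign_smul_sign]
    exact sign_congr _ ⟨0, by simp only [totalDeg_cons]; ring⟩

/-- The signed sum of `F A B` over all ways of splitting the list `L` into two complementary
sublists `A` and `B`, weighted with the Koszul sign of the unshuffle `L ↦ A ++ B`. -/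
def unshuffleSum (dg : X → ℤ) : List X → (List X → List X → W) → W
  | [], F => F [] []
  | x :: L, F => unshuffleSum dg L (fun A B => F (x :: A) B) +
      unshuffleSum dg L (fun A B => (dg x * totalDeg dg A).negOnePow • F A (x :: B))

variable {dg : X → ℤ}

/-- Only the pairs `(A, B)` for which `A ++ B` is a rearrangement of `L` matter for an unshuffle
sum. -/
lemma unshuffleSum_congr {L : List X} {F G : List X → List X → W}
    (h : ∀ A B, (A ++ B).Perm L → F A B = G A B) :
    unshuffleSum dg L F = unshuffleSum dg L G := by
  induction L generalizing F G with
  | nil => exact h [] [] (by simp)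
  | cons x L ih =>
    simp only [unshuffleSum]
    congr 1
    · exact ih fun A B hp => h _ _ (by simpa using hp)
    · exact ih fun A B hp => by
        rw [h A (x :: B) (List.perm_middle.trans (hp.cons x))]

lemma unshuffleSum_add (L : List X) (F G : List X → List X → W) :
    unshuffleSum dg L (fun A B => F A B + G A B) = unshuffleSum dg L F + unshuffleSum dg L G := by
  induction L generalizing F G with
  | nil => rfl
  | cons x L ih => simp only [unshuffleSum, smul_add, ih]; abel

/-- Unshuffle sums commute with additive maps. -/
lemma map_unshuffleSum {W' : Type*} [AddCommGroup W'] (φ : W →+ W') (L : List X)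
    (F : List X → List X → W) :
    φ (unshuffleSum dg L F) = unshuffleSum dg L (fun A B => φ (F A B)) := by
  induction L generalizing F with
  | nil => rfl
  | cons x L ih =>
    simp only [unshuffleSum, map_add, ih]
    congr 2
    ext A B
    simp [Units.smul_def]

lemma unshuffleSum_zero (L : List X) : unshuffleSum dg L (fun _ _ => (0 : W)) = 0 := by
  induction L with
  | nil => rfl
  | cons x L ih => simp [unshuffleSum, ih]

lemma unshuffleSum_sign (a : ℤ) (L : List X) (F : List X → List X → W) :
    a.negOnePow • unshuffleSum dg L F = unshuffleSum dg L (fun A B => a.negOnePow • F A B) :=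
  map_unshuffleSum (DistribSMul.toAddMonoidHom W a.negOnePow) L F

/-- Only the trivial unshuffle counts if `F A B` vanishes for nonempty `B`. -/
lemma unshuffleSum_eq_left {L : List X} {F : List X → List X → W}
    (h : ∀ A x B, (A ++ x :: B).Perm L → F A (x :: B) = 0) : unshuffleSum dg L F = F L [] := by
  induction L generalizing F with
  | nil => rfl
  | cons x L ih =>
    simp only [unshuffleSum]
    rw [ih fun A y B hp => h (x :: A) y B (by simpa using hp)]
    rw [unshuffleSum_congr (G := fun _ _ => 0), unshuffleSum_zero, add_zero]
    intro A B hp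
    rw [h A x B (List.perm_middle.trans (hp.cons x)), smul_zero]

/-- Cocommutativity of the unshuffle coproduct. -/
lemma unshuffleSum_comm (L : List X) (F : List X → List X → W) :
    unshuffleSum dg L F =
      unshuffleSum dg L (fun A B => (totalDeg dg A * totalDeg dg B).negOnePow • F B A) := by
  induction L generalizing F with
  | nil => simp [unshuffleSum]
  | cons x L ih =>
    simp only [unshuffleSum]
    rw [add_comm]
    congr 1
    · rw [ih]
      refine unshuffleSum_congr fun A B _ => ?_
      rw [sign_smul_sign]
      exact sign_congr _ ⟨0, by simp only [totalDeg_cons]; ring⟩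
    · rw [ih]
      refine unshuffleSum_congr fun A B _ => ?_
      rw [sign_smul_sign]
      exact sign_congr _ ⟨-(dg x * totalDeg dg A), by simp only [totalDeg_cons]; ring⟩

/-- Coassociativity of the unshuffle coproduct. -/
lemma unshuffleSum_assoc (L : List X) (F : List X → List X → List X → W) :
    unshuffleSum dg L (fun A M => unshuffleSum dg M (fun B C => F A B C)) =
      unshuffleSum dg L (fun M C => unshuffleSum dg M (fun A B => F A B C)) := by
  induction L generalizing F with
  | nil => rfl
  | cons x L ih =>
    simp only [unshuffleSum, smul_add, unshuffleSum_add, ih, unshuffleSum_sign]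
    rw [← add_assoc]
    congr 1
    refine unshuffleSum_congr fun M C _ => unshuffleSum_congr fun A B hp => ?_
    rw [sign_smul_sign, ← totalDeg_perm dg hp]
    refine sign_congr _ ?_
    simp only [totalDeg_append]
    exact ⟨0, by ring⟩

/-- The unshuffle sum of a function that is graded symmetric in both arguments is graded
symmetric. -/
lemma gradedSymm_unshuffleSum {F : List X → List X → W}
    (h₁ : ∀ B, GradedSymm dg fun A => F A B) (h₂ : ∀ A, GradedSymm dg fun B => F A B) :
    GradedSymm dg fun L => unshuffleSum dg L F := by
  intro p x y q
  induction p generalizing F with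
  | nil =>
    simp only [List.nil_append, unshuffleSum, smul_add, unshuffleSum_sign, sign_smul_sign,
      totalDeg_cons]
    have e : ∀ a b c d a' b' c' d' : W, a = a' → b = c' → c = b' → d = d' →
        a + b + (c + d) = a' + b' + (c' + d') := by
      rintro a b c d a' b' c' d' rfl rfl rfl rfl; abel
    -- the terms in which `x` and `y` go to different sides are exchanged
    refine e _ _ _ _ _ _ _ _ ?_ ?_ ?_ ?_ <;> refine unshuffleSum_congr fun A B _ => ?_
    · simpa using h₁ B [] x y A
    · exact sign_congr _ ⟨-(dg x * dg y), by ring⟩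
    · exact sign_congr _ ⟨0, by ring⟩
    · have := h₂ A [] x y B
      simp only [List.nil_append] at this
      rw [this, sign_smul_sign]
      exact sign_congr _ ⟨0, by ring⟩
  | cons z p ih =>
    simp only [List.cons_append, unshuffleSum, smul_add]
    congr 1
    · exact ih (fun B => (h₁ B).cons z) (fun A => h₂ (z :: A))
    · refine ih (fun B p x y q => ?_) (fun A p x y q => ?_)
      · simp only [h₁ (z :: B) p x y q, sign_smul_sign]
        refine sign_congr _ ?_
        simp only [totalDeg_append, totalDeg_cons]
        exact ⟨0, by ring⟩
      · have := h₂ A (z :: p) x y q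
        simp only [List.cons_append] at this
        simp only [this, sign_smul_sign]
        exact sign_congr _ ⟨0, by ring⟩

/-- Only the trivial unshuffle counts if `F A B` vanishes for nonempty `A`. -/
lemma unshuffleSum_eq_right {L : List X} {F : List X → List X → W}
    (h : ∀ x A B, F (x :: A) B = 0) : unshuffleSum dg L F = F [] L := by
  induction L generalizing F with
  | nil => rfl
  | cons x L ih =>
    simp only [unshuffleSum, h, unshuffleSum_zero, zero_add]
    rw [ih fun y A B => by rw [h, smul_zero]]
    simp

lemma unshuffleSum_mem (M : AddSubgroup W) {L : List X} {F : List X → List X → W}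
    (h : ∀ A B, (A ++ B).Perm L → F A B ∈ M) : unshuffleSum dg L F ∈ M := by
  induction L generalizing F with
  | nil => exact h [] [] (by simp)
  | cons x L ih =>
    refine M.add_mem (ih fun A B hp => h _ _ (by simpa using hp)) (ih fun A B hp => ?_)
    rw [Units.smul_def]
    exact M.zsmul_mem (h A (x :: B) (List.perm_middle.trans (hp.cons x))) _

/-- The function of lists that is `g x` on the singleton `[x]` and zero on all other lists. -/
def onSingleton (g : X → W) : List X → W
  | [x] => g x
  | _ => 0

@[simp] lemma onSingleton_singleton (g : X → W) (x : X) : onSingleton g [x] = g x := rfl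

@[simp] lemma onSingleton_nil (g : X → W) : onSingleton g [] = 0 := rfl

@[simp] lemma onSingleton_cons_cons (g : X → W) (x y : X) (L : List X) :
    onSingleton g (x :: y :: L) = 0 := rfl

lemma gradedSymm_onSingleton (g : X → W) : GradedSymm dg (onSingleton g) := by
  rintro (_ | ⟨a, _ | _⟩) x y q <;> simp

/-- Pulling each letter to the front in turn and summing counts a graded symmetric function once
for each letter. -/
lemma unshuffleSum_onSingleton {F : List X → W} (hF : GradedSymm dg F) (L : List X) :
    unshuffleSum dg L (fun A B => onSingleton (fun x => F (x :: B)) A) = L.length • F L := by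
  induction L generalizing F with
  | nil => simp [unshuffleSum]
  | cons y L ih =>
    rw [unshuffleSum, unshuffleSum_eq_right fun x A B => rfl, List.length_cons, add_comm _ 1,
      add_smul, one_smul, ← ih (hF.cons y)]
    congr 1
    refine unshuffleSum_congr fun A B _ => ?_
    rcases A with _ | ⟨x, _ | _⟩
    · simp
    · have := hF [] y x B
      simp only [List.nil_append] at this
      simp [this]
    · simp

/-- The signed sum of the values of `c` over all permutations of a list of `k` letters, computed
by choosing the letter in front and recursing; it is zero on nonempty lists if `k = 0`. -/
def symmetrize (dg : X → ℤ) : ℕ → (List X → W) → List X → W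
  | 0, c, [] => c []
  | 0, _, _ :: _ => 0
  | k + 1, c, L => unshuffleSum dg L fun A B =>
      onSingleton (fun x => symmetrize dg k (fun w => c (x :: w)) B) A

lemma gradedSymm_symmetrize (k : ℕ) (c : List X → W) : GradedSymm dg (symmetrize dg k c) := by
  induction k generalizing c with
  | zero => rintro (_ | _) x y q <;> simp [symmetrize]
  | succ k ih =>
    refine gradedSymm_unshuffleSum (fun B => gradedSymm_onSingleton _) (fun A => ?_)
    rcases A with _ | ⟨x, _ | _⟩
    · intro p x y q; simp
    · exact ih _
    · intro p x y q; simp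

lemma symmetrize_mem (M : AddSubgroup W) {k : ℕ} {c : List X → W} {L : List X}
    (h : ∀ w : List X, w.Perm L → c w ∈ M) : symmetrize dg k c L ∈ M := by
  induction k generalizing c L with
  | zero =>
    cases L
    · exact h [] (by simp)
    · exact M.zero_mem
  | succ k ih =>
    refine unshuffleSum_mem M fun A B hp => ?_
    rcases A with _ | ⟨x, _ | _⟩
    · exact M.zero_mem
    · exact ih fun w hw => h _ ((hw.cons x).trans hp)
    · exact M.zero_mem

/-- If `c` lifts a graded symmetric function `F` through `φ`, then its symmetrization lifts
`k! • F`. -/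
lemma map_symmetrize {W' : Type*} [AddCommGroup W'] (φ : W →+ W') {F : List X → W'}
    (hF : GradedSymm dg F) {c : List X → W} {L : List X}
    (h : ∀ w : List X, w.Perm L → φ (c w) = F w) :
    φ (symmetrize dg L.length c L) = L.length.factorial • F L := by
  obtain ⟨k, hk⟩ : ∃ k, L.length = k := ⟨_, rfl⟩
  rw [hk]
  induction k generalizing c L F with
  | zero =>
    obtain rfl := List.length_eq_zero_iff.1 hk
    simpa [symmetrize] using h [] (by simp)
  | succ k ih =>
    rw [symmetrize, map_unshuffleSum, Nat.factorial_succ, mul_comm, mul_smul, ← hk,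
      ← unshuffleSum_onSingleton hF, ← DistribSMul.toAddMonoidHom_apply, map_unshuffleSum]
    refine unshuffleSum_congr fun A B hp => ?_
    rcases A with _ | ⟨x, _ | _⟩
    · simp
    · have hl := hp.length_eq
      simp only [List.length_append, List.length_cons, List.length_nil] at hl
      exact ih (hF.cons x) (fun w hw => h _ ((hw.cons x).trans hp)) (by omega)
    · simp

end Unshuffle

/-! ### Graded resolutions and homogeneous elements -/

/-- A resolution `⋯ → V₋₂ → V₋₁ → A → 0` by free `O`-modules, encoded as one module `V` with a
basis `e` of homogeneous elements: the basis vector `e i` has the negative degree `dg i`, the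
component of degree `d` is the span of the basis vectors of degree `d` (see `part`), and the hook
`π` is extended by zero to the components other than `V₋₁`. -/
structure GradedResolution (O A V I : Type*) [CommRing O] [AddCommGroup A] [Module O A]
    [AddCommGroup V] [Module O V] where
  /-- a basis of homogeneous elements -/
  e : Module.Basis I O V
  /-- the degrees of the basis vectors -/
  dg : I → ℤ
  dg_neg : ∀ i, dg i < 0
  /-- the differential -/
  D : V →ₗ[O] V
  D_mem_span : ∀ i, D (e i) ∈ Submodule.span O (e '' {j | dg j = dg i + 1})
  D_D : ∀ v, D (D v) = 0
  /-- the hook, extended by zero -/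
  π : V →ₗ[O] A
  π_basis : ∀ i, dg i ≠ -1 → π (e i) = 0
  π_D : ∀ v, π (D v) = 0
  exists_π_eq : ∀ a, ∃ v ∈ Submodule.span O (e '' {j | dg j = -1}), π v = a
  exists_D_eq : ∀ d < 0, ∀ v ∈ Submodule.span O (e '' {j | dg j = d}), D v = 0 → π v = 0 →
    ∃ u ∈ Submodule.span O (e '' {j | dg j = d - 1}), D u = v

namespace GradedResolution

section Parts

variable {O A V I : Type*} [CommRing O] [AddCommGroup A] [Module O A]
  [AddCommGroup V] [Module O V] (R : GradedResolution O A V I)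

/-- The component of degree `d`. -/
noncomputable def part (d : ℤ) : Submodule O V := Submodule.span O (R.e '' {j | R.dg j = d})

lemma basis_mem (i : I) : R.e i ∈ R.part (R.dg i) := Submodule.subset_span ⟨i, rfl, rfl⟩

/-- The type of homogeneous elements of `V`, each labelled with a degree in which it lives. -/
abbrev Homog : Type _ := Σ d : ℤ, R.part d

/-- The element of `V` underlying a homogeneous element. -/
abbrev val (x : R.Homog) : V := x.2

/-- A basis vector as a homogeneous element. -/
noncomputable abbrev base (i : I) : R.Homog := ⟨R.dg i, R.e i, R.basis_mem i⟩

variable {R}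

lemma part_induction {d : ℤ} {P : V → Prop} (basis : ∀ i, R.dg i = d → P (R.e i)) (zero : P 0)
    (add : ∀ u ∈ R.part d, ∀ v ∈ R.part d, P u → P v → P (u + v))
    (smul : ∀ (f : O), ∀ v ∈ R.part d, P v → P (f • v)) {v : V} (hv : v ∈ R.part d) : P v := by
  refine Submodule.span_induction (p := fun v _ => P v) ?_ zero (fun u v hu hv => add u hu v hv)
    (fun f v hv => smul f v hv) hv
  rintro _ ⟨i, hi, rfl⟩
  exact basis i hi

lemma part_mem_of_basis {W : Type*} [AddCommGroup W] [Module O W] (φ : V →ₗ[O] W)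
    (S : Submodule O W) {d : ℤ} (h : ∀ i, R.dg i = d → φ (R.e i) ∈ S) {v : V}
    (hv : v ∈ R.part d) : φ v ∈ S :=
  part_induction (P := fun v => φ v ∈ S) h (by simp)
    (fun u _ v _ hu hv => by rw [map_add]; exact S.add_mem hu hv)
    (fun f v _ hv => by rw [map_smul]; exact S.smul_mem f hv) hv

lemma eq_of_basis {W : Type*} [AddCommGroup W] [Module O W] {φ ψ : V →ₗ[O] W} {d : ℤ}
    (h : ∀ i, R.dg i = d → φ (R.e i) = ψ (R.e i)) {v : V} (hv : v ∈ R.part d) : φ v = ψ v := by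
  have := part_mem_of_basis (φ - ψ) ⊥ (fun i hi => by simp [h i hi]) hv
  simpa [sub_eq_zero] using this

lemma eq_zero_of_nonneg {d : ℤ} (hd : 0 ≤ d) {v : V} (hv : v ∈ R.part d) : v = 0 :=
  (Submodule.mem_bot O).1 (part_mem_of_basis LinearMap.id ⊥
    (fun i hi => absurd (R.dg_neg i) (by omega)) hv)

lemma π_eq_zero {d : ℤ} (hd : d ≠ -1) {v : V} (hv : v ∈ R.part d) : R.π v = 0 := by
  simpa using part_mem_of_basis R.π ⊥ (fun i hi => by simp [R.π_basis i (by omega)]) hv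

lemma sign_smul_mem {S : Submodule O V} (a : ℤ) {v : V} (hv : v ∈ S) : a.negOnePow • v ∈ S := by
  rw [Units.smul_def]
  exact S.toAddSubgroup.zsmul_mem hv _

lemma totalDeg_eq {L : List R.Homog} {w : List I} (h : w.map R.dg = L.map Sigma.fst) :
    totalDeg R.dg w = totalDeg Sigma.fst L := by
  rw [totalDeg, h, totalDeg]

/-- Words of a given length have degree at most minus their length, all letters being of negative
degree. -/
lemma totalDeg_word (w : List I) : totalDeg R.dg w ≤ -(w.length : ℤ) := by
  induction w with
  | nil => simp
  | cons i w ih =>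
    have := R.dg_neg i
    simp only [totalDeg_cons, List.length_cons]
    push_cast
    omega

lemma totalDeg_map_base (w : List I) : totalDeg Sigma.fst (w.map R.base) = totalDeg R.dg w := by
  simp [totalDeg, Function.comp_def]

lemma map_val_base (w : List I) : (w.map R.base).map R.val = w.map R.e := by
  simp [Function.comp_def]

lemma totalDeg_le_of_perm {A B : List R.Homog} {w : List I} (h : (A ++ B).Perm (w.map R.base)) :
    totalDeg Sigma.fst A ≤ -(A.length : ℤ) ∧ totalDeg Sigma.fst B ≤ -(B.length : ℤ) := by
  have key : ∀ L : List R.Homog, (∀ x ∈ L, x.1 < 0) → totalDeg Sigma.fst L ≤ -(L.length : ℤ) := by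
    intro L hL
    induction L with
    | nil => simp
    | cons x L ih =>
      have h1 := hL x (by simp)
      have h2 := ih fun y hy => hL y (by simp [hy])
      simp only [totalDeg_cons, List.length_cons]
      push_cast
      omega
  have hneg : ∀ x ∈ A ++ B, x.1 < 0 := by
    intro x hx
    obtain ⟨i, -, rfl⟩ := List.mem_map.1 (h.mem_iff.1 hx)
    exact R.dg_neg i
  exact ⟨key A fun x hx => hneg x (by simp [hx]), key B fun x hx => hneg x (by simp [hx])⟩

lemma totalDeg_add_of_perm {A B : List R.Homog} {w : List I}
    (h : (A ++ B).Perm (w.map R.base)) :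
    totalDeg Sigma.fst A + totalDeg Sigma.fst B = totalDeg R.dg w := by
  rw [← totalDeg_append, totalDeg_perm _ h, totalDeg_map_base]

end Parts

/-! ### Multilinear extensions of structure constants -/

section Multilinear

variable {O A V I W : Type*} [CommRing O] [AddCommGroup A] [Module O A]
  [AddCommGroup V] [Module O V] [AddCommGroup W] [Module O W] (R : GradedResolution O A V I)

/-- The `O`-multilinear extension of a function `c` of words in the basis vectors to a function of
lists of vectors. -/
noncomputable def multiExt : List V → (List I → V) → V
  | [], c => c []
  | v :: L, c => R.e.constr O (fun i => multiExt L (fun w => c (i :: w))) v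

variable {R}

lemma multiExt_add (p : List V) (u v : V) (q : List V) (c : List I → V) :
    R.multiExt (p ++ (u + v) :: q) c = R.multiExt (p ++ u :: q) c + R.multiExt (p ++ v :: q) c := by
  induction p generalizing c with
  | nil => simp [multiExt]
  | cons a p ih =>
    simp only [List.cons_append, multiExt, ih]
    rw [← LinearMap.add_apply, ← map_add]
    rfl

lemma multiExt_smul (p : List V) (f : O) (v : V) (q : List V) (c : List I → V) :
    R.multiExt (p ++ (f • v) :: q) c = f • R.multiExt (p ++ v :: q) c := by
  induction p generalizing c with
  | nil => simp [multiExt]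
  | cons a p ih =>
    simp only [List.cons_append, multiExt, ih]
    rw [← LinearMap.smul_apply, ← map_smul]
    rfl

lemma multiExt_basis (w : List I) (c : List I → V) : R.multiExt (w.map R.e) c = c w := by
  induction w generalizing c with
  | nil => rfl
  | cons i w ih => simp [multiExt, ih]

/-- A value of a multilinear extension lies in every submodule that contains the values on the
words with the same degrees. -/
lemma multiExt_mem (S : Submodule O V) (L : List R.Homog) {c : List I → V}
    (h : ∀ w : List I, w.map R.dg = L.map Sigma.fst → c w ∈ S) :
    R.multiExt (L.map R.val) c ∈ S := by
  induction L generalizing c with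
  | nil => exact h [] rfl
  | cons x L ih =>
    refine part_mem_of_basis _ S (fun i hi => ?_) x.2.2
    rw [Module.Basis.constr_basis]
    exact ih fun w hw => h _ (by simp [hi, hw])

lemma multiExt_congr (L : List R.Homog) {c c' : List I → V}
    (h : ∀ w : List I, w.map R.dg = L.map Sigma.fst → c w = c' w) :
    R.multiExt (L.map R.val) c = R.multiExt (L.map R.val) c' := by
  induction L generalizing c c' with
  | nil => exact h [] rfl
  | cons x L ih =>
    refine eq_of_basis (fun i hi => ?_) x.2.2
    rw [Module.Basis.constr_basis, Module.Basis.constr_basis]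
    exact ih fun w hw => h _ (by simp [hi, hw])

lemma multiExt_comp (ψ : V →ₗ[O] V) (L : List V) (c : List I → V) :
    R.multiExt L (fun w => ψ (c w)) = ψ (R.multiExt L c) := by
  induction L generalizing c with
  | nil => rfl
  | cons v L ih =>
    simp only [multiExt, ih]
    exact DFunLike.congr_fun (R.e.constr_comp O ψ _) v

/-- Exchanging the first two arguments amounts to exchanging the first two letters in the structure
constants. -/
lemma multiExt_swap (x y : V) (q : List V) (c : List I → V) :
    R.multiExt (x :: y :: q) c =
      R.multiExt (y :: x :: q) (fun w => match w with
        | j :: i :: w => c (i :: j :: w)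
        | _ => 0) := by
  simp only [multiExt, Module.Basis.constr_apply, Finsupp.smul_sum]
  rw [Finsupp.sum_comm]
  refine Finsupp.sum_congr fun j _ => Finsupp.sum_congr fun i _ => smul_comm _ _ _

lemma gradedSymm_multiExt {c : List I → V} (hc : GradedSymm R.dg c) :
    GradedSymm Sigma.fst fun L : List R.Homog => R.multiExt (L.map R.val) c := by
  intro p x y q
  induction p generalizing c with
  | nil =>
    let ψ : V →ₗ[O] V := (x.1 * y.1).negOnePow • LinearMap.id
    have hψ : ∀ v, ψ v = (x.1 * y.1).negOnePow • v := fun v => rfl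
    simp only [List.nil_append, List.map_cons]
    rw [multiExt_swap, ← hψ, ← multiExt_comp]
    refine multiExt_congr (y :: x :: q) fun w hw => ?_
    rcases w with _ | ⟨j, _ | ⟨i, w⟩⟩
    · simp at hw
    · simp at hw
    · simp only [List.map_cons, List.cons.injEq] at hw
      have := hc [] i j w
      simpa [hψ, hw.1, hw.2.1] using this
  | cons z p ih =>
    let ψ : V →ₗ[O] V := (x.1 * y.1).negOnePow • LinearMap.id
    have hψ : ∀ v, ψ v = (x.1 * y.1).negOnePow • v := fun v => rfl
    simp only [List.cons_append, List.map_cons, multiExt]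
    simp only [fun i => ih (hc.cons i), ← hψ]
    exact DFunLike.congr_fun (R.e.constr_comp O ψ _) _

/-- Structure constants solving a lifting problem for the words in a permutation-invariant set `P`
can be made graded symmetric by averaging over all permutations. -/
lemma exists_gradedSymm_lift (hO : ∀ n : ℕ, n ≠ 0 → IsUnit (n : O)) (φ : V →ₗ[O] W)
    {F : List I → W}
    (hF : GradedSymm R.dg F) {P : List I → Prop} (hP : ∀ w w', w.Perm w' → P w → P w')
    (h : ∀ w, P w → ∃ v ∈ R.part (totalDeg R.dg w + 1), φ v = F w) :
    ∃ δ : List I → V, GradedSymm R.dg δ ∧ (∀ w, δ w ∈ R.part (totalDeg R.dg w + 1)) ∧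
      (∀ w, ¬ P w → δ w = 0) ∧ ∀ w, P w → φ (δ w) = F w := by
  have h' : ∀ w, ∃ v ∈ R.part (totalDeg R.dg w + 1), (P w → φ v = F w) ∧ (¬ P w → v = 0) := by
    intro w
    by_cases hw : P w
    · obtain ⟨v, hv, hv'⟩ := h w hw
      exact ⟨v, hv, fun _ => hv', fun h => absurd hw h⟩
    · exact ⟨0, Submodule.zero_mem _, fun h => absurd h hw, fun _ => rfl⟩
  choose c hmem hlift hzero using h'
  refine ⟨fun w => Ring.inverse (w.length.factorial : O) • symmetrize R.dg w.length c w,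
    ?_, ?_, ?_, ?_⟩
  · intro p x y q
    have hl : (p ++ x :: y :: q).length = (p ++ y :: x :: q).length := by simp
    simp only [hl]
    rw [gradedSymm_symmetrize _ _ p x y q, smul_comm]
  · intro w
    refine Submodule.smul_mem _ _ (symmetrize_mem (R.part _).toAddSubgroup fun u hu => ?_)
    rw [← totalDeg_perm _ hu]
    exact hmem u
  · intro w hw
    have : symmetrize R.dg w.length c w ∈ (⊥ : AddSubgroup V) :=
      symmetrize_mem ⊥ fun u hu => hzero u fun hu' => hw (hP _ _ hu hu')
    simp only
    rw [AddSubgroup.mem_bot.1 this, smul_zero]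
  · intro w hw
    have := map_symmetrize φ.toAddMonoidHom hF (c := c) (L := w) fun u hu =>
      hlift u (hP _ _ hu.symm hw)
    rw [LinearMap.toAddMonoidHom_coe] at this
    rw [map_smul, this, ← Nat.cast_smul_eq_nsmul O, smul_smul,
      Ring.inverse_mul_cancel _ (hO _ (Nat.factorial_ne_zero _)), one_smul]

end Multilinear

/-! ### The flat connection of a basis -/

section Flat

variable {O A V I : Type*} [CommRing O] [LieRing A] [Module O A] [AddCommGroup V] [Module O V]

lemma lie_one_eq_zero [LieRingModule A O] [LieRinehartRing O A] (a : A) : ⁅a, (1 : O)⁆ = 0 := by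
  have h := LieRinehartRing.leibniz_mul_right a (1 : O) 1
  simpa using h

variable (R : GradedResolution O A V I)

/-- The grading involution, `(-1) ^ d` on the component of degree `d`. -/
noncomputable def grading : V →ₗ[O] V :=
  R.e.constr O fun i => (R.dg i).negOnePow • R.e i

variable {R} in
lemma grading_apply {d : ℤ} {v : V} (hv : v ∈ R.part d) : R.grading v = d.negOnePow • v :=
  eq_of_basis (φ := R.grading) (ψ := d.negOnePow • LinearMap.id)
    (fun i hi => by simp [grading, hi]) hv

variable [LieRingModule A O]

/-- The covariant derivative along `a` for the flat connection on `V` whose horizontal sections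
are the basis vectors. -/
noncomputable def flat (a : A) (v : V) : V :=
  R.e.repr.symm ((R.e.repr v).mapRange (fun f => ⁅a, f⁆) (lie_zero a))

/-- The part of the binary bracket that is not `O`-bilinear: the antisymmetrized flat covariant
derivative. It vanishes on basis vectors. -/
noncomputable def derivPart : List V → V
  | [x, y] => R.flat (R.π x) y + R.flat (R.π y) (R.grading x)
  | _ => 0

variable {R}

lemma repr_flat (a : A) (v : V) (i : I) : R.e.repr (R.flat a v) i = ⁅a, R.e.repr v i⁆ := by
  simp [flat]

@[simp] lemma derivPart_pair (x y : V) :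
    R.derivPart [x, y] = R.flat (R.π x) y + R.flat (R.π y) (R.grading x) := rfl

lemma derivPart_of_length {L : List V} (h : L.length ≠ 2) : R.derivPart L = 0 := by
  rcases L with _ | ⟨_, _ | ⟨_, _ | _⟩⟩ <;> first | rfl | simp at h

lemma flat_add (a : A) (u v : V) : R.flat a (u + v) = R.flat a u + R.flat a v := by
  apply R.e.repr.injective; ext i; simp [repr_flat]

lemma add_flat (a b : A) (v : V) : R.flat (a + b) v = R.flat a v + R.flat b v := by
  apply R.e.repr.injective; ext i; simp [repr_flat]

lemma zero_flat (v : V) : R.flat (0 : A) v = 0 := by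
  apply R.e.repr.injective; ext i; simp [repr_flat]

lemma flat_zero (a : A) : R.flat a (0 : V) = 0 := by
  apply R.e.repr.injective; ext i; simp [repr_flat]

lemma flat_sign (a : A) (d : ℤ) (v : V) :
    R.flat a (d.negOnePow • v) = d.negOnePow • R.flat a v := by
  have : ∀ n : ℤ, R.flat a (n • v) = n • R.flat a v := fun n =>
    map_zsmul (AddMonoidHom.mk' (R.flat a) (flat_add a)) n v
  rw [Units.smul_def, this, ← Units.smul_def]

lemma derivPart_add (p : List V) (u v : V) (q : List V) :
    R.derivPart (p ++ (u + v) :: q) = R.derivPart (p ++ u :: q) + R.derivPart (p ++ v :: q) := by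
  rcases p with _ | ⟨a, _ | ⟨b, p⟩⟩
  · rcases q with _ | ⟨c, _ | _⟩
    · simp [derivPart]
    · simp [flat_add, add_flat]; abel
    · simp [derivPart]
  · rcases q with _ | _
    · simp [flat_add, add_flat]; abel
    · simp [derivPart]
  · rw [derivPart_of_length, derivPart_of_length, derivPart_of_length, add_zero]
    all_goals simp

/-- The derivative part is graded symmetric: the hook of `x` is nonzero in degree `-1` only, where
the Koszul sign of `x` and `y` is the value of the grading involution on `y`. -/
lemma gradedSymm_derivPart :
    GradedSymm Sigma.fst fun L : List R.Homog => R.derivPart (L.map R.val) := by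
  have key : ∀ x y : R.Homog,
      (x.1 * y.1).negOnePow • y.1.negOnePow • R.flat (R.π x.2) (y.2 : V) =
        R.flat (R.π x.2) (y.2 : V) := by
    intro x y
    by_cases hx : x.1 = -1
    · rw [sign_smul_sign, show x.1 * y.1 + y.1 = 0 by rw [hx]; ring, Int.negOnePow_zero, one_smul]
    · rw [π_eq_zero hx x.2.2, zero_flat, smul_zero, smul_zero]
  rintro (_ | ⟨a, p⟩) x y q
  · rcases q with _ | _
    · simp only [List.nil_append, List.map_cons, List.map_nil, derivPart_pair, smul_add]
      rw [grading_apply x.2.2, grading_apply y.2.2, flat_sign, flat_sign, key x y, add_comm]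
      congr 1
      conv_rhs => rw [← key y x, sign_smul_sign, sign_smul_sign]
      exact sign_congr _ ⟨-(y.1 * x.1), by ring⟩
    · simp [derivPart]
  · simp only
    rw [derivPart_of_length, derivPart_of_length, smul_zero]
    all_goals
      simp only [List.cons_append, List.map_cons, List.map_append, List.length_cons,
        List.length_append]
      omega

variable [LieRinehartRing O A]

lemma flat_smul (a : A) (f : O) (v : V) : R.flat a (f • v) = ⁅a, f⁆ • v + f • R.flat a v := by
  apply R.e.repr.injective; ext i; simp [repr_flat]; ring

lemma smul_flat (a : A) (f : O) (v : V) : R.flat (f • a) v = f • R.flat a v := by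
  apply R.e.repr.injective; ext i; simp [repr_flat]

open Classical in
lemma flat_basis (a : A) (i : I) : R.flat a (R.e i) = 0 := by
  apply R.e.repr.injective
  ext j
  rw [repr_flat, R.e.repr_self, map_zero, Finsupp.coe_zero, Pi.zero_apply, Finsupp.single_apply]
  split_ifs
  · exact lie_one_eq_zero a
  · exact lie_zero a

lemma flat_mem (a : A) {d : ℤ} {v : V} (hv : v ∈ R.part d) : R.flat a v ∈ R.part d := by
  refine part_induction (P := fun v => R.flat a v ∈ R.part d) (fun i _ => ?_) ?_
    (fun u _ v _ hu hv => ?_) (fun f v hv' hv => ?_) hv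
  · rw [flat_basis]; exact Submodule.zero_mem _
  · rw [flat_zero]; exact Submodule.zero_mem _
  · rw [flat_add]; exact Submodule.add_mem _ hu hv
  · rw [flat_smul]
    exact Submodule.add_mem _ (Submodule.smul_mem _ _ hv') (Submodule.smul_mem _ _ hv)

lemma derivPart_basis (w : List I) : R.derivPart (w.map R.e) = 0 := by
  rcases w with _ | ⟨_, _ | ⟨_, _ | _⟩⟩ <;> try rfl
  simp [grading, flat_sign, flat_basis]

lemma derivPart_mem (L : List R.Homog) :
    R.derivPart (L.map R.val) ∈ R.part (totalDeg Sigma.fst L + 1) := by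
  have key : ∀ x y : R.Homog, R.flat (R.π x.2) y.2 ∈ R.part (x.1 + (y.1 + 0) + 1) := by
    intro x y
    by_cases hx : x.1 = -1
    · have := flat_mem (R.π x.2) y.2.2
      rwa [show x.1 + (y.1 + 0) + 1 = y.1 by omega]
    · rw [π_eq_zero hx x.2.2, zero_flat]
      exact Submodule.zero_mem _
  rcases L with _ | ⟨x, _ | ⟨y, _ | _⟩⟩ <;> try exact Submodule.zero_mem _
  simp only [List.map_cons, List.map_nil, derivPart_pair, totalDeg_cons, totalDeg_nil]
  refine Submodule.add_mem _ (key x y) ?_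
  rw [grading_apply x.2.2, flat_sign]
  have := key y x
  rw [show y.1 + (x.1 + 0) = x.1 + (y.1 + 0) by ring] at this
  exact sign_smul_mem _ this

end Flat

/-! ### Brackets and the Jacobiator -/

section Bracket

variable {O A V I : Type*} [CommRing O] [LieRing A] [Module O A] [LieRingModule A O]
  [AddCommGroup V] [Module O V] (R : GradedResolution O A V I)

/-- Families of structure constants, prescribing the brackets of basis vectors, with the symmetry
and the degree of an `L∞`-structure, with the differential as unary bracket and with a binary
bracket that the hook maps to the bracket of `A`. -/
structure Admissible (c : List I → V) : Prop where
  symm : GradedSymm R.dg c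
  mem : ∀ w, c w ∈ R.part (totalDeg R.dg w + 1)
  nil : c [] = 0
  single : ∀ i, c [i] = R.D (R.e i)
  hook : ∀ i j, R.dg i = -1 → R.dg j = -1 → R.π (c [i, j]) = ⁅R.π (R.e i), R.π (R.e j)⁆

/-- The brackets with structure constants `c`, as a function of lists of vectors: the multilinear
extension of `c`, corrected in arity two by the derivative terms of the Leibniz rule. -/
noncomputable def bracket (c : List I → V) (L : List V) : V :=
  R.multiExt L c + R.derivPart L

/-- The bracket of homogeneous elements. -/
noncomputable abbrev hbracket (c : List I → V) (L : List R.Homog) : V :=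
  R.bracket c (L.map R.val)

/-- The Jacobiator: the left-hand side of the higher Jacobi identity. -/
noncomputable def jacobiator (c : List I → V) (L : List R.Homog) : V :=
  unshuffleSum Sigma.fst L fun A B => R.bracket c (R.hbracket c A :: B.map R.val)

/-- The anchor as a function of lists: the anchor of `x` on the singleton `[x]`, zero on all other
lists. -/
def anchorList : List V → O → O
  | [x], f => ⁅R.π x, f⁆
  | _, _ => 0

variable {R} {c : List I → V}

/-- The brackets are `O`-linear in each argument except in arity two. -/
lemma bracket_smul (p : List V) (f : O) (v : V) (q : List V) (h : p.length + q.length ≠ 1) :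
    R.bracket c (p ++ (f • v) :: q) = f • R.bracket c (p ++ v :: q) := by
  rw [bracket, bracket, multiExt_smul, derivPart_of_length, derivPart_of_length]
  · simp
  all_goals
    simp only [List.length_append, List.length_cons]
    omega

/-- The bracket of a list only depends on the structure constants of the words with the same
degrees. -/
lemma bracket_congr {c' : List I → V} (L : List R.Homog)
    (h : ∀ w : List I, w.map R.dg = L.map Sigma.fst → c w = c' w) :
    R.hbracket c L = R.hbracket c' L := by
  rw [hbracket, bracket, multiExt_congr L h, ← bracket]

lemma anchorList_of_length {L : List V} (h : L.length ≠ 1) (f : O) : R.anchorList L f = 0 := by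
  rcases L with _ | ⟨x, _ | _⟩
  · rfl
  · simp at h
  · rfl

lemma anchorList_zero (L : List V) : R.anchorList L 0 = 0 := by
  rcases L with _ | ⟨x, _ | _⟩
  · rfl
  · exact lie_zero _
  · rfl

lemma anchorList_of_totalDeg {L : List R.Homog} (h : totalDeg Sigma.fst L ≠ -1) (f : O) :
    R.anchorList (L.map R.val) f = 0 := by
  rcases L with _ | ⟨x, _ | _⟩
  · rfl
  · simp only [List.map_cons, List.map_nil, anchorList]
    rw [π_eq_zero (by simpa using h) x.2.2, zero_lie]
  · rfl

lemma Admissible.bracket_nil (hc : R.Admissible c) : R.bracket c [] = 0 := by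
  simp [bracket, multiExt, derivPart, hc.nil]

lemma Admissible.bracket_single (hc : R.Admissible c) (v : V) : R.bracket c [v] = R.D v := by
  simp only [bracket, multiExt, derivPart, add_zero, hc.single]
  exact DFunLike.congr_fun (R.e.constr_self O R.D) v

lemma bracket_add (p : List V) (u v : V) (q : List V) :
    R.bracket c (p ++ (u + v) :: q) = R.bracket c (p ++ u :: q) + R.bracket c (p ++ v :: q) := by
  simp only [bracket, multiExt_add, derivPart_add]; abel

/-- The bracket as an additive map of its first argument. -/
noncomputable def bracketHom (R : GradedResolution O A V I) (c : List I → V) (L : List V) :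
    V →+ V :=
  AddMonoidHom.mk' (fun v => R.bracket c (v :: L)) fun u v => bracket_add [] u v L

@[simp] lemma bracketHom_apply (L : List V) (v : V) :
    bracketHom R c L v = R.bracket c (v :: L) := rfl

lemma bracket_sign (a : ℤ) (v : V) (L : List V) :
    R.bracket c ((a.negOnePow • v) :: L) = a.negOnePow • R.bracket c (v :: L) := by
  rw [← bracketHom_apply, Units.smul_def, map_zsmul, ← Units.smul_def, bracketHom_apply]

lemma bracket_zero_cons (L : List V) : R.bracket c (0 :: L) = 0 := map_zero (bracketHom R c L)

lemma bracket_eq_zero_of_nonneg (p : List V) (x : R.Homog) (hx : 0 ≤ x.1) (q : List V) :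
    R.bracket c (p ++ (x.2 : V) :: q) = 0 := by
  have h := bracket_add (R := R) (c := c) p 0 0 q
  rw [eq_zero_of_nonneg hx x.2.2]
  simpa using h

/-- For degree reasons the hook kills the brackets of three and more elements. -/
lemma Admissible.π_bracket_of_length (hc : R.Admissible c) {L : List R.Homog}
    (h : 3 ≤ L.length) : R.π (R.hbracket c L) = 0 := by
  rw [hbracket, bracket, derivPart_of_length (by simp; omega), add_zero]
  refine multiExt_mem (LinearMap.ker R.π) L fun w hw => ?_
  have h1 := totalDeg_word w (R := R)
  have h2 : w.length = L.length := by simpa using congrArg List.length hw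
  exact π_eq_zero (by omega) (hc.mem w)

lemma jacobiator_cons (y : R.Homog) (L : List R.Homog) :
    R.jacobiator c (y :: L) = unshuffleSum Sigma.fst L fun A B =>
      R.bracket c (R.bracket c (y.2 :: A.map R.val) :: B.map R.val) +
      (y.1 * totalDeg Sigma.fst A).negOnePow •
        R.bracket c (R.hbracket c A :: y.2 :: B.map R.val) := by
  rw [jacobiator, unshuffleSum, ← unshuffleSum_add]
  rfl

lemma jacobiator_add_cons (d : ℤ) (u v : R.part d) (L : List R.Homog) :
    R.jacobiator c (⟨d, u + v⟩ :: L) =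
      R.jacobiator c (⟨d, u⟩ :: L) + R.jacobiator c (⟨d, v⟩ :: L) := by
  simp only [jacobiator_cons, ← unshuffleSum_add]
  refine unshuffleSum_congr fun A B _ => ?_
  have h1 := bracket_add (R := R) (c := c) [] (u : V) (v : V) (A.map R.val)
  have h2 := bracket_add (R := R) (c := c) [R.hbracket c A] (u : V) (v : V) (B.map R.val)
  have h3 := bracket_add (R := R) (c := c) [] (R.bracket c (u :: A.map R.val))
    (R.bracket c (v :: A.map R.val)) (B.map R.val)
  simp only [List.nil_append, List.cons_append] at h1 h2 h3
  simp only [Submodule.coe_add, h1, h2, h3, smul_add]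
  abel

lemma Admissible.gradedSymm_bracket (hc : R.Admissible c) :
    GradedSymm Sigma.fst (R.hbracket c) := by
  intro p x y q
  simp only [hbracket, bracket, smul_add]
  rw [← gradedSymm_derivPart p x y q, ← gradedSymm_multiExt hc.symm p x y q]

lemma Admissible.bracket_swap (hc : R.Admissible c) (x y : R.Homog) (L : List R.Homog) :
    R.bracket c (x.2 :: y.2 :: L.map R.val) =
      (x.1 * y.1).negOnePow • R.bracket c (y.2 :: x.2 :: L.map R.val) := by
  simpa [hbracket] using hc.gradedSymm_bracket [] x y L

lemma Admissible.jacobiator_singleton (hc : R.Admissible c) (x : R.Homog) :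
    R.jacobiator c [x] = 0 := by
  simp [jacobiator, unshuffleSum, hbracket, hc.bracket_single, hc.bracket_nil, R.D_D,
    bracket_zero_cons]

variable [LieRinehartRing O A]

lemma bracket_basis (w : List I) : R.bracket c (w.map R.e) = c w := by
  rw [bracket, multiExt_basis, derivPart_basis, add_zero]

/-- The Leibniz rule in the first argument. -/
lemma bracket_smul_cons (f : O) {d : ℤ} {v : V} (hv : v ∈ R.part d) (L : List R.Homog) :
    R.bracket c ((f • v) :: L.map R.val) =
      f • R.bracket c (v :: L.map R.val) + d.negOnePow • R.anchorList (L.map R.val) f • v := by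
  by_cases h : L.length = 1
  · obtain ⟨x, rfl⟩ := List.length_eq_one_iff.1 h
    have := multiExt_smul (R := R) [] f v [(x.2 : V)] c
    simp only [List.nil_append] at this
    simp only [bracket, List.map_cons, List.map_nil, derivPart_pair, map_smul,
      smul_flat, flat_smul, smul_add, this, anchorList, grading_apply hv]
    rw [smul_comm]
    abel
  · have := bracket_smul (R := R) (c := c) [] f v (L.map R.val) (by simpa using h)
    rw [anchorList_of_length (by simpa using h), zero_smul, smul_zero, add_zero]
    exact this

namespace Admissible

lemma bracket_mem (hc : R.Admissible c) (L : List R.Homog) :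
    R.hbracket c L ∈ R.part (totalDeg Sigma.fst L + 1) := by
  refine Submodule.add_mem _ (multiExt_mem _ L fun w hw => ?_) (derivPart_mem L)
  rw [← totalDeg_eq hw]
  exact hc.mem w

/-- The bracket of a list of homogeneous elements, labelled with its degree. -/
noncomputable def br (hc : R.Admissible c) (L : List R.Homog) : R.Homog :=
  ⟨totalDeg Sigma.fst L + 1, R.hbracket c L, hc.bracket_mem L⟩

lemma jacobiator_mem (hc : R.Admissible c) (L : List R.Homog) :
    R.jacobiator c L ∈ R.part (totalDeg Sigma.fst L + 2) := by
  refine unshuffleSum_mem (R.part _).toAddSubgroup fun A B hp => ?_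
  have := hc.bracket_mem (hc.br A :: B)
  rwa [totalDeg_cons, show (hc.br A).1 = totalDeg Sigma.fst A + 1 from rfl,
    show totalDeg Sigma.fst A + 1 + totalDeg Sigma.fst B + 1 = totalDeg Sigma.fst L + 2 by
      rw [← totalDeg_perm _ hp, totalDeg_append]; ring] at this

lemma gradedSymm_jacobiator (hc : R.Admissible c) : GradedSymm Sigma.fst (R.jacobiator c) := by
  refine gradedSymm_unshuffleSum (fun B p x y q => ?_)
    (fun A => hc.gradedSymm_bracket.cons (hc.br A))
  simp only [hc.gradedSymm_bracket p x y q, bracket_sign]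

/-- The hook maps the binary bracket to the bracket of `A`: this holds on basis vectors, and both
sides satisfy the same Leibniz rules. -/
lemma π_bracket_pair (hc : R.Admissible c) (x y : R.Homog) (hx : x.1 = -1) (hy : y.1 = -1) :
    R.π (R.bracket c [(x.2 : V), (y.2 : V)]) = ⁅R.π x.2, R.π y.2⁆ := by
  obtain ⟨d, x, hxm⟩ := x
  obtain ⟨d', y, hym⟩ := y
  obtain rfl : d = -1 := hx
  obtain rfl : d' = -1 := hy
  have swap : ∀ x ∈ R.part (-1), ∀ y ∈ R.part (-1), R.bracket c [x, y] = -R.bracket c [y, x] := by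
    intro x hx y hy
    simpa using hc.bracket_swap ⟨-1, x, hx⟩ ⟨-1, y, hy⟩ []
  -- it suffices to check the first argument on basis vectors
  have lin : ∀ y ∈ R.part (-1),
      (∀ i, R.dg i = -1 → R.π (R.bracket c [R.e i, y]) = ⁅R.π (R.e i), R.π y⁆) →
      ∀ x ∈ R.part (-1), R.π (R.bracket c [x, y]) = ⁅R.π x, R.π y⁆ := by
    intro y hy hb x hx
    refine part_induction (P := fun x => R.π (R.bracket c [x, y]) = ⁅R.π x, R.π y⁆) hb ?_
      (fun u _ v _ hu hv => ?_) (fun f v hv h => ?_) hx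
    · simp [bracket_zero_cons]
    · have := bracket_add (R := R) (c := c) [] u v [y]
      simp only [List.nil_append] at this
      simp [this, hu, hv]
    · have : R.bracket c [f • v, y] = f • R.bracket c [v, y] + -(⁅R.π y, f⁆ • v) := by
        simpa [anchorList] using bracket_smul_cons (c := c) f hv [⟨-1, y, hy⟩]
      rw [this, map_add, map_smul, h, map_neg, map_smul, map_smul,
        ← lie_skew (f • R.π v) (R.π y), LieRinehartRing.leibniz_smul_right, neg_add,
        ← smul_neg f, lie_skew]
  have half : ∀ i, R.dg i = -1 → ∀ y ∈ R.part (-1),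
      R.π (R.bracket c [R.e i, y]) = ⁅R.π (R.e i), R.π y⁆ := by
    intro i hi y hy
    have hi' : R.e i ∈ R.part (-1) := hi ▸ R.basis_mem i
    rw [swap _ hi' _ hy, map_neg, lin _ hi' (fun j hj => ?_) y hy, lie_skew]
    rw [show [R.e j, R.e i] = [j, i].map R.e from rfl, bracket_basis]
    exact hc.hook j i hj hi
  exact lin y hym (fun i hi => half i hi y hym) x hxm

lemma π_bracket (hc : R.Admissible c) (x y : R.Homog) :
    R.π (R.bracket c [(x.2 : V), (y.2 : V)]) = ⁅R.π x.2, R.π y.2⁆ := by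
  by_cases h : x.1 = -1 ∧ y.1 = -1
  · exact hc.π_bracket_pair x y h.1 h.2
  have hr : ⁅R.π x.2, R.π y.2⁆ = 0 := by
    by_cases hx : x.1 = -1
    · rw [π_eq_zero (fun hy => h ⟨hx, hy⟩) y.2.2, lie_zero]
    · rw [π_eq_zero hx x.2.2, zero_lie]
  rw [hr]
  -- in total degree `-2`, one of the arguments has nonnegative degree, hence is zero
  by_cases hs : x.1 + y.1 = -2
  · rcases le_or_gt 0 x.1 with hx | hx
    · have := bracket_eq_zero_of_nonneg (c := c) [] x hx [y.2]
      simp only [List.nil_append] at this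
      rw [this, map_zero]
    · have := bracket_eq_zero_of_nonneg (c := c) [x.2] y (by omega) []
      simp only [List.cons_append, List.nil_append] at this
      rw [this, map_zero]
  · have := hc.bracket_mem [x, y]
    simp only [totalDeg_cons, totalDeg_nil] at this
    exact π_eq_zero (by omega) this

/-- The anchor is compatible with the brackets: on lists of one element this says that the anchor
kills boundaries, on lists of two elements that the anchor preserves brackets, and on longer lists
all terms vanish for degree reasons. -/
lemma anchor_curvature (hc : R.Admissible c) (L : List R.Homog) (f : O) :
    (unshuffleSum Sigma.fst L fun A B =>
      R.anchorList (B.map R.val) (R.anchorList (A.map R.val) f) +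
        R.anchorList (R.hbracket c A :: B.map R.val) f) = 0 := by
  rcases L with _ | ⟨x, _ | ⟨y, _ | ⟨z, L⟩⟩⟩
  · simp [unshuffleSum, anchorList, hbracket, hc.bracket_nil]
  · simp [unshuffleSum, anchorList, hbracket, hc.bracket_single, R.π_D]
  · simp only [unshuffleSum, hbracket, List.map_cons, List.map_nil, anchorList, totalDeg_cons,
      totalDeg_nil, hc.π_bracket x y, zero_add, add_zero, mul_zero, Int.negOnePow_zero, one_smul,
      smul_zero]
    by_cases h : x.1 = -1 ∧ y.1 = -1
    · rw [show x.1 * y.1 = 1 by rw [h.1, h.2]; norm_num, lie_lie]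
      simp
    · by_cases hx : x.1 = -1
      · simp [π_eq_zero (fun hy => h ⟨hx, hy⟩) y.2.2]
      · simp [π_eq_zero hx x.2.2]
  · rw [unshuffleSum_eq_left]
    · simp only [List.map_nil, anchorList, zero_add]
      rw [hc.π_bracket_of_length (by simp), zero_lie]
    · intro A b B hp
      have hl := hp.length_eq
      simp only [List.length_append, List.length_cons] at hl
      rw [anchorList_of_length (L := R.hbracket c A :: _) (by simp), add_zero]
      by_cases hA : A.length = 1
      · refine anchorList_of_length ?_ _
        simp only [List.map_cons, List.length_cons, List.length_map]
        omega
      · rw [anchorList_of_length (L := A.map R.val) (by simpa using hA), anchorList_zero]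

/-- The Jacobiator is `O`-linear in its first argument. The first derivatives of `f` cancel in pairs
exchanged by cocommutativity of the unshuffle coproduct, the second derivatives cancel by
compatibility of the anchor with the brackets. -/
lemma jacobiator_smul_cons (hc : R.Admissible c) (f : O) (y : R.Homog) (L : List R.Homog) :
    R.jacobiator c (⟨y.1, f • y.2⟩ :: L) = f • R.jacobiator c (y :: L) := by
  -- the terms with a first derivative of `f`
  let G : List R.Homog → List R.Homog → V := fun A B =>
    y.1.negOnePow • R.anchorList (A.map R.val) f • R.bracket c (y.2 :: B.map R.val)
  have hterm : ∀ A B : List R.Homog,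
      R.bracket c (R.bracket c ((f • y.2 : R.part y.1) :: A.map R.val) :: B.map R.val) +
        (y.1 * totalDeg Sigma.fst A).negOnePow •
          R.bracket c (R.hbracket c A :: (f • y.2 : R.part y.1) :: B.map R.val) =
      f • (R.bracket c (R.bracket c (y.2 :: A.map R.val) :: B.map R.val) +
        (y.1 * totalDeg Sigma.fst A).negOnePow •
          R.bracket c (R.hbracket c A :: y.2 :: B.map R.val)) +
      (G A B + (-1 : ℤ).negOnePow •
        (totalDeg Sigma.fst A * totalDeg Sigma.fst B).negOnePow • G B A) +
      (R.anchorList (B.map R.val) (R.anchorList (A.map R.val) f) +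
        R.anchorList (R.hbracket c A :: B.map R.val) f) • (y.2 : V) := by
    intro A B
    have e1 := bracket_add (R := R) (c := c) [] (f • R.bracket c (y.2 :: A.map R.val))
      (y.1.negOnePow • R.anchorList (A.map R.val) f • (y.2 : V)) (B.map R.val)
    have e2 := bracket_smul_cons (c := c) f (hc.br (y :: A)).2.2 B
    have e3 := bracket_smul_cons (c := c) (R.anchorList (A.map R.val) f) y.2.2 B
    have e4 := hc.bracket_swap (hc.br A) ⟨y.1, f • y.2⟩ B
    have e5 := bracket_smul_cons (c := c) f y.2.2 (hc.br A :: B)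
    have e6 := hc.bracket_swap (hc.br A) y B
    simp only [br, hbracket, List.map_cons, List.nil_append, Submodule.coe_smul, totalDeg_cons]
      at e1 e2 e3 e4 e5 e6
    rw [Submodule.coe_smul, bracket_smul_cons f y.2.2, e1, e2, bracket_sign, e3]
    simp only [hbracket, e4, e5, e6]
    -- the anchor of `B` vanishes unless `B` has degree `-1`
    have e7 : (y.1 + totalDeg Sigma.fst A + 1).negOnePow • R.anchorList (B.map R.val) f •
        R.bracket c (y.2 :: A.map R.val) = (-1 : ℤ).negOnePow •
        (totalDeg Sigma.fst A * totalDeg Sigma.fst B).negOnePow • G B A := by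
      by_cases hB : totalDeg Sigma.fst B = -1
      · simp only [G, sign_smul_sign, hB]
        exact sign_congr _ ⟨totalDeg Sigma.fst A + 1, by ring⟩
      · simp only [G, anchorList_of_totalDeg hB, zero_smul, smul_zero]
    rw [e7]
    simp only [G, smul_add, add_smul, sign_smul_sign, smul_comm f]
    have e8 : ∀ v : V, (y.1 + y.1).negOnePow • v = v := fun v => by
      rw [sign_congr (b := 0) v ⟨y.1, by ring⟩, Int.negOnePow_zero, one_smul]
    have e9 : ∀ v : V, (y.1 * totalDeg Sigma.fst A +
        ((totalDeg Sigma.fst A + 1) * y.1 + y.1)).negOnePow • v = v := fun v => by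
      rw [sign_congr (b := 0) v ⟨y.1 * totalDeg Sigma.fst A + y.1, by ring⟩,
        Int.negOnePow_zero, one_smul]
    simp only [e8, e9]
    abel
  rw [jacobiator_cons, jacobiator_cons]
  simp only [hterm, unshuffleSum_add]
  have h1 := map_unshuffleSum (dg := Sigma.fst) (DistribSMul.toAddMonoidHom V f) L fun A B =>
    R.bracket c (R.bracket c (y.2 :: A.map R.val) :: B.map R.val) +
      (y.1 * totalDeg Sigma.fst A).negOnePow • R.bracket c (R.hbracket c A :: y.2 :: B.map R.val)
  have h2 := map_unshuffleSum (dg := Sigma.fst)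
    (LinearMap.toSpanSingleton O V (y.2 : V)).toAddMonoidHom L fun A B =>
      R.anchorList (B.map R.val) (R.anchorList (A.map R.val) f) +
        R.anchorList (R.hbracket c A :: B.map R.val) f
  rw [hc.anchor_curvature] at h2
  simp only [DistribSMul.toAddMonoidHom_apply, map_zero, LinearMap.toAddMonoidHom_coe,
    LinearMap.toSpanSingleton_apply] at h1 h2
  have h3 := unshuffleSum_sign (W := V) (dg := Sigma.fst) (-1) L fun A B : List R.Homog =>
    (totalDeg Sigma.fst A * totalDeg Sigma.fst B).negOnePow • G B A
  rw [← unshuffleSum_comm] at h3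
  rw [← h1, ← h2, ← h3]
  simp [unshuffleSum_add]

/-- The Bianchi identity `J ∘ ℓ = ℓ ∘ J`: the terms with two disjoint inner brackets cancel in
pairs, the bracket being odd. -/
lemma bianchi (hc : R.Admissible c) (h2 : ∀ v : V, v = -v → v = 0) (L : List R.Homog) :
    (unshuffleSum Sigma.fst L fun A B => R.jacobiator c (hc.br A :: B)) =
      unshuffleSum Sigma.fst L fun M B => R.bracket c (R.jacobiator c M :: B.map R.val) := by
  simp only [jacobiator_cons, unshuffleSum_add]
  rw [unshuffleSum_assoc (W := V) (dg := Sigma.fst) L fun A B C =>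
      R.bracket c (R.bracket c ((hc.br A).2 :: B.map R.val) :: C.map R.val),
    unshuffleSum_assoc (W := V) (dg := Sigma.fst) L fun A B C =>
      ((hc.br A).1 * totalDeg Sigma.fst B).negOnePow •
        R.bracket c (R.hbracket c B :: (hc.br A).2 :: C.map R.val)]
  -- the terms with two disjoint inner brackets equal their own negatives
  have hzero : ∀ M C : List R.Homog, (unshuffleSum Sigma.fst M fun A B =>
      ((hc.br A).1 * totalDeg Sigma.fst B).negOnePow •
        R.bracket c (R.hbracket c B :: (hc.br A).2 :: C.map R.val)) = 0 := by
    intro M C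
    apply h2
    have h3 := unshuffleSum_sign (W := V) (dg := Sigma.fst) (-1) M fun A B : List R.Homog =>
      ((hc.br A).1 * totalDeg Sigma.fst B).negOnePow •
        R.bracket c (R.hbracket c B :: (hc.br A).2 :: C.map R.val)
    refine Eq.trans ?_ (h3.symm.trans (by simp))
    conv_lhs => rw [unshuffleSum_comm]
    refine unshuffleSum_congr fun A B _ => ?_
    have := hc.bracket_swap (hc.br A) (hc.br B) C
    simp only [br] at this ⊢
    rw [this]
    simp only [sign_smul_sign]
    refine sign_congr _ ⟨totalDeg Sigma.fst A * totalDeg Sigma.fst B +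
      totalDeg Sigma.fst A + 1, ?_⟩
    ring
  simp only [hzero, unshuffleSum_zero, add_zero]
  refine unshuffleSum_congr fun M C _ => ?_
  rw [jacobiator, ← bracketHom_apply, map_unshuffleSum]
  rfl

end Admissible

end Bracket

/-! ### Existence of structure constants -/

section Existence

variable {O A V I : Type*} [CommRing O] [LieRing A] [Module O A]
  [AddCommGroup V] [Module O V] {R : GradedResolution O A V I}
  {c : List I → V}

/-- There are admissible structure constants: on pairs of basis vectors, lift the bracket of `A`
through the hook; on longer words, take zero. -/
lemma exists_admissible (hO : ∀ n : ℕ, n ≠ 0 → IsUnit (n : O)) : ∃ c, R.Admissible c := by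
  let F : List I → A := fun w => match w with
    | [i, j] => ⁅R.π (R.e i), R.π (R.e j)⁆
    | _ => 0
  have hF : GradedSymm R.dg F := by
    rintro (_ | ⟨a, _ | ⟨b, p⟩⟩) x y q
    · rcases q with _ | _
      · simp only [F, List.nil_append]
        by_cases h : R.dg x = -1 ∧ R.dg y = -1
        · rw [h.1, h.2, ← lie_skew]
          simp
        · by_cases hx : R.dg x = -1
          · rw [R.π_basis y fun hy => h ⟨hx, hy⟩]
            simp
          · rw [R.π_basis x hx]
            simp
      · simp [F]
    · simp [F]
    · simp [F]
  obtain ⟨δ, hsymm, hmem, hzero, hlift⟩ := exists_gradedSymm_lift (R := R) hO R.π hF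
    (P := fun w => w.length = 2) (fun w w' hp h => by rw [← hp.length_eq, h]) (by
      intro w hw
      obtain ⟨i, j, rfl⟩ := List.length_eq_two.1 hw
      by_cases h : R.dg i = -1 ∧ R.dg j = -1
      · rw [show totalDeg R.dg [i, j] + 1 = -1 by simp [h.1, h.2]]
        exact R.exists_π_eq _
      · refine ⟨0, Submodule.zero_mem _, ?_⟩
        simp only [F, map_zero]
        by_cases hx : R.dg i = -1
        · rw [R.π_basis j fun hy => h ⟨hx, hy⟩, lie_zero]
        · rw [R.π_basis i hx, zero_lie])
  let c : List I → V := fun w => match w with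
    | [i] => R.D (R.e i)
    | w => δ w
  have hcδ : ∀ w, w.length ≠ 1 → c w = δ w := by
    rintro (_ | ⟨a, _ | ⟨b, p⟩⟩) h
    · rfl
    · simp at h
    · rfl
  refine ⟨c, ?_, ?_, ?_, ?_, ?_⟩
  · intro p x y q
    have hl : ∀ a b : I, (p ++ a :: b :: q).length ≠ 1 := fun a b => by
      simp only [List.length_append, List.length_cons]
      omega
    rw [hcδ _ (hl x y), hcδ _ (hl y x), hsymm]
  · intro w
    by_cases hw : w.length = 1
    · obtain ⟨i, rfl⟩ := List.length_eq_one_iff.1 hw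
      rw [totalDeg_cons, totalDeg_nil, add_zero]
      exact R.D_mem_span i
    · rw [hcδ w hw]
      exact hmem w
  · exact hzero [] (by simp)
  · exact fun _ => rfl
  · exact fun i j _ _ => hlift [i, j] rfl

variable [LieRingModule A O] [LieRinehartRing O A]

namespace Admissible

/-- The Jacobiator vanishes on all lists of homogeneous elements of given degrees if it vanishes
on the words in the basis vectors of these degrees. -/
lemma jacobiator_eq_zero (hc : R.Admissible c) (L : List R.Homog)
    (h : ∀ w : List I, w.map R.dg = L.map Sigma.fst → R.jacobiator c (w.map R.base) = 0) :
    R.jacobiator c L = 0 := by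
  suffices key : ∀ (L : List R.Homog) (w : List I),
      (∀ u : List I, u.map R.dg = w.map R.dg ++ L.map Sigma.fst →
        R.jacobiator c (u.map R.base) = 0) → R.jacobiator c (w.map R.base ++ L) = 0 from
    key L [] (by simpa using h)
  intro L
  induction L with
  | nil => exact fun w hw => by simpa using hw w (by simp)
  | cons x L ih =>
    intro w hw
    obtain ⟨d, v, hv⟩ := x
    rw [hc.gradedSymm_jacobiator.move]
    suffices ∀ hv' : v ∈ R.part d, R.jacobiator c (⟨d, v, hv'⟩ :: (w.map R.base ++ L)) = 0 by
      rw [this hv, smul_zero]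
    refine part_induction (P := fun v => ∀ hv' : v ∈ R.part d,
      R.jacobiator c (⟨d, v, hv'⟩ :: (w.map R.base ++ L)) = 0) ?_ ?_ ?_ ?_ hv
    · rintro i rfl hi
      have h1 := hc.gradedSymm_jacobiator.move (w.map R.base) (R.base i) L
      have h2 := ih (w ++ [i]) fun u hu => hw u (by simpa using hu)
      rw [List.map_append, List.append_assoc, List.map_singleton, List.singleton_append, h1,
        smul_eq_zero_iff_eq] at h2
      exact h2
    · intro h0
      have := hc.jacobiator_smul_cons 0 ⟨d, 0, h0⟩ (w.map R.base ++ L)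
      rw [zero_smul, zero_smul] at this
      exact this
    · intro u hu v hv h1 h2 h3
      have := GradedResolution.jacobiator_add_cons (c := c) d ⟨u, hu⟩ ⟨v, hv⟩ (w.map R.base ++ L)
      rw [h1, h2, add_zero] at this
      exact this
    · intro f v hv h1 h2
      have := hc.jacobiator_smul_cons f ⟨d, v, hv⟩ (w.map R.base ++ L)
      rw [h1, smul_zero] at this
      exact this

/-- The summand of the Jacobiator belonging to an unshuffle depends only on the structure constants
of degree at least that of the whole list, respectively of higher degree unless the inner bracket
involves all arguments. -/
lemma bracket_bracket_congr (hc : R.Admissible c) {c' : List I → V} {A B : List R.Homog}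
    {w : List I} (hp : (A ++ B).Perm (w.map R.base))
    (h : ∀ u, totalDeg R.dg w < totalDeg R.dg u → c u = c' u)
    (h' : B ≠ [] ∨ ∀ u, totalDeg R.dg u = totalDeg R.dg w → c u = c' u) :
    R.bracket c (R.hbracket c A :: B.map R.val) =
      R.bracket c' (R.hbracket c' A :: B.map R.val) := by
  have h1 := totalDeg_add_of_perm hp
  have h2 := (totalDeg_le_of_perm hp).2
  have h3 : R.hbracket c A = R.hbracket c' A := by
    refine bracket_congr A fun u hu => ?_
    rcases h' with h' | h'
    · have := List.length_pos_of_ne_nil h'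
      refine h u ?_
      rw [totalDeg_eq hu]
      omega
    · rcases lt_or_eq_of_le (show totalDeg R.dg w ≤ totalDeg R.dg u by
        rw [totalDeg_eq hu]; omega) with h4 | h4
      · exact h u h4
      · exact h' u h4.symm
  rw [← h3]
  refine bracket_congr (hc.br A :: B) fun u hu => h u ?_
  rw [totalDeg_eq hu, totalDeg_cons, show (hc.br A).1 = totalDeg Sigma.fst A + 1 from rfl]
  omega

/-- The Jacobiator of a word only depends on the structure constants of at least its degree. -/
lemma jacobiator_congr (hc : R.Admissible c) {c' : List I → V} {w : List I}
    (h : ∀ u, totalDeg R.dg w ≤ totalDeg R.dg u → c u = c' u) :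
    R.jacobiator c (w.map R.base) = R.jacobiator c' (w.map R.base) :=
  unshuffleSum_congr fun _ _ hp =>
    hc.bracket_bracket_congr hp (fun u hu => h u hu.le) (Or.inr fun u hu => h u hu.ge)

/-- Changing the structure constants of lowest degree changes the Jacobiator by a boundary. -/
lemma jacobiator_sub (hc : R.Admissible c) {c' : List I → V} (hc' : R.Admissible c') {w : List I}
    (h : ∀ u, totalDeg R.dg w < totalDeg R.dg u → c u = c' u) :
    R.jacobiator c' (w.map R.base) = R.jacobiator c (w.map R.base) + R.D (c' w - c w) := by
  let T : (List I → V) → List R.Homog → List R.Homog → V :=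
    fun c A B => R.bracket c (R.hbracket c A :: B.map R.val)
  have h1 : unshuffleSum Sigma.fst (w.map R.base) (fun A B => T c' A B - T c A B) =
      R.D (c' w - c w) := by
    rw [unshuffleSum_eq_left]
    · simp only [T, List.map_nil, hc.bracket_single, hc'.bracket_single, hbracket, map_val_base,
        bracket_basis, map_sub]
    · intro A x B hp
      rw [sub_eq_zero]
      exact (hc.bracket_bracket_congr hp h (Or.inl (by simp))).symm
  rw [← h1, jacobiator, jacobiator, ← unshuffleSum_add]
  exact unshuffleSum_congr fun A B _ => (add_sub_cancel _ _).symm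

/-- The Jacobiator vanishes in total degree at least `-2`, its values then being of nonnegative
degree. -/
lemma jacobiator_of_totalDeg (hc : R.Admissible c) (L : List R.Homog)
    (h : -2 ≤ totalDeg Sigma.fst L) : R.jacobiator c L = 0 :=
  eq_zero_of_nonneg (by omega) (hc.jacobiator_mem L)

/-- The hook kills the Jacobiator: in degree `-1` this is the Jacobi identity of `A`. -/
lemma π_jacobiator (hc : R.Admissible c) (w : List I) :
    R.π (R.jacobiator c (w.map R.base)) = 0 := by
  by_cases h3 : totalDeg R.dg w = -3
  swap
  · have := hc.jacobiator_mem (w.map R.base)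
    rw [totalDeg_map_base] at this
    exact π_eq_zero (by omega) this
  have hsum : R.π (R.jacobiator c (w.map R.base)) =
      unshuffleSum Sigma.fst (w.map R.base) fun A B =>
        R.π (R.bracket c (R.hbracket c A :: B.map R.val)) :=
    map_unshuffleSum R.π.toAddMonoidHom _ _
  have h1 : ∀ v : V, R.π (R.bracket c [v]) = 0 := fun v => by rw [hc.bracket_single, R.π_D]
  have h2 : ∀ (A : List R.Homog) (z : R.Homog),
      R.π (R.bracket c [R.hbracket c A, R.val z]) = ⁅R.π (R.hbracket c A), R.π z.2⁆ :=
    fun A z => hc.π_bracket (hc.br A) z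
  have h3' : ∀ (A B : List R.Homog), 2 ≤ B.length →
      R.π (R.bracket c (R.hbracket c A :: B.map R.val)) = 0 :=
    fun A B hB => hc.π_bracket_of_length (L := hc.br A :: B) (by simpa using hB)
  have h4 : ∀ x y : R.Homog, R.π (R.hbracket c [x, y]) = ⁅R.π x.2, R.π y.2⁆ := hc.π_bracket
  have h5 : ∀ x : R.Homog, R.π (R.hbracket c [x]) = 0 := fun x => h1 x.2
  have hdeg := totalDeg_word w (R := R)
  rcases w with _ | ⟨i, _ | ⟨j, _ | ⟨k, _ | ⟨l, w⟩⟩⟩⟩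
  · simp at h3
  · rw [List.map_singleton, hc.jacobiator_singleton, map_zero]
  · have h6 := h3' [] [R.base i, R.base j] (by simp)
    simp only [List.map_cons, List.map_nil] at h6
    rw [hsum]
    simp only [List.map_cons, List.map_nil, unshuffleSum, h1, h2, h5, h6]
    simp
  · have hi := R.dg_neg i
    have hj := R.dg_neg j
    have hk := R.dg_neg k
    simp only [totalDeg_cons, totalDeg_nil] at h3
    have h6 := h3' [] [R.base i, R.base j, R.base k] (by simp)
    have h7 := fun x y z => h3' [x] [y, z] (by simp)
    simp only [List.map_cons, List.map_nil] at h6 h7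
    rw [hsum]
    simp only [List.map_cons, List.map_nil, unshuffleSum, h1, h2, h4, h6, h7, totalDeg_cons,
      totalDeg_nil, show R.dg i = -1 by omega, show R.dg j = -1 by omega,
      show R.dg k = -1 by omega]
    have jac : ∀ a b c : A, ⁅a, ⁅b, c⁆⁆ - ⁅b, ⁅a, c⁆⁆ + (⁅c, ⁅a, b⁆⁆ - ⁅a, ⁅c, b⁆⁆) +
        (⁅b, ⁅c, a⁆⁆ - ⁅c, ⁅b, a⁆⁆) = 0 := by
      intro a b c
      rw [← lie_skew a c, ← lie_skew c b, ← lie_skew b a, lie_neg, lie_neg, lie_neg]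
      calc _ = (⁅a, ⁅b, c⁆⁆ + ⁅b, ⁅c, a⁆⁆ + ⁅c, ⁅a, b⁆⁆) +
            (⁅a, ⁅b, c⁆⁆ + ⁅b, ⁅c, a⁆⁆ + ⁅c, ⁅a, b⁆⁆) := by abel
        _ = 0 := by rw [lie_jacobi, add_zero]
    simpa [show Int.negOnePow 2 = 1 from Int.negOnePow_even 2 even_two] using
      jac (R.π (R.e i)) (R.π (R.e j)) (R.π (R.e k))
  · simp only [List.length_cons] at hdeg
    push_cast at hdeg
    omega

end Admissible

/-- The inductive step: the structure constants of degree `-(s + 1)` can be changed so that the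
Jacobiator vanishes in this degree. The Jacobiator is a cycle by the Bianchi identity, hence a
boundary because `R` is a resolution. -/
lemma Admissible.exists_step (hO : ∀ n : ℕ, n ≠ 0 → IsUnit (n : O)) (hc : R.Admissible c) (s : ℕ)
    (h : ∀ w, -(s : ℤ) ≤ totalDeg R.dg w → R.jacobiator c (w.map R.base) = 0) :
    ∃ c', R.Admissible c' ∧
      (∀ w, -((s + 1 : ℕ) : ℤ) ≤ totalDeg R.dg w → R.jacobiator c' (w.map R.base) = 0) ∧
      ∀ w, totalDeg R.dg w ≠ -((s + 1 : ℕ) : ℤ) → c' w = c w := by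
  rcases Nat.lt_or_ge s 2 with hs | hs
  · refine ⟨c, hc, fun w hw => hc.jacobiator_of_totalDeg _ ?_, fun _ _ => rfl⟩
    rw [totalDeg_map_base]
    push_cast at hw
    omega
  have h2 : ∀ v : V, v = -v → v = 0 := by
    intro v hv
    have h3 : (2 : O) • v = 0 := by
      rw [two_smul]
      nth_rewrite 1 [hv]
      exact neg_add_cancel v
    exact (hO 2 two_ne_zero).smul_eq_zero.1 (by exact_mod_cast h3)
  have hJ : ∀ L : List R.Homog, -(s : ℤ) ≤ totalDeg Sigma.fst L → R.jacobiator c L = 0 :=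
    fun L hL => hc.jacobiator_eq_zero L fun w hw => h w (by rw [totalDeg_eq hw]; exact hL)
  -- the Jacobiator is a cycle
  have hcycle : ∀ w, totalDeg R.dg w = -((s + 1 : ℕ) : ℤ) →
      R.D (R.jacobiator c (w.map R.base)) = 0 := by
    intro w hw
    have hb := hc.bianchi h2 (w.map R.base)
    rw [unshuffleSum_congr (G := fun _ _ => 0), unshuffleSum_zero, unshuffleSum_eq_left] at hb
    · rw [List.map_nil, hc.bracket_single] at hb
      exact hb.symm
    · intro A x B hp
      have h3 := totalDeg_add_of_perm hp
      have h4 := (totalDeg_le_of_perm hp).2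
      rw [hJ A, bracket_zero_cons]
      simp only [List.length_cons] at h4
      push_cast at h4 hw
      omega
    · intro A B hp
      have h3 := totalDeg_add_of_perm hp
      refine hJ _ ?_
      rw [totalDeg_cons, show (hc.br A).1 = totalDeg Sigma.fst A + 1 from rfl]
      push_cast at hw
      omega
  -- correct the structure constants by graded symmetric preimages of minus the Jacobiator
  obtain ⟨δ, hsymm, hmem, hzero, hlift⟩ := exists_gradedSymm_lift (R := R) hO R.D
    (F := fun w => -R.jacobiator c (w.map R.base))
    (P := fun w => totalDeg R.dg w = -((s + 1 : ℕ) : ℤ) ∧ 2 ≤ w.length)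
    (by
      intro p x y q
      have := hc.gradedSymm_jacobiator (p.map R.base) (R.base x) (R.base y) (q.map R.base)
      simp only [List.map_append, List.map_cons, this, smul_neg])
    (fun w w' hp hw => by rwa [← totalDeg_perm _ hp, ← hp.length_eq])
    (by
      rintro w ⟨hw, -⟩
      have h3 := hc.jacobiator_mem (w.map R.base)
      rw [totalDeg_map_base] at h3
      obtain ⟨u, hu, hu'⟩ := R.exists_D_eq (totalDeg R.dg w + 2) (by push_cast at hw; omega) _ h3
        (hcycle w hw) (hc.π_jacobiator w)
      refine ⟨-u, Submodule.neg_mem _ ?_, by rw [map_neg, hu']⟩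
      rwa [show totalDeg R.dg w + 2 - 1 = totalDeg R.dg w + 1 by ring] at hu)
  have hc' : R.Admissible (fun w => c w + δ w) := by
    refine ⟨fun p x y q => ?_, fun w => Submodule.add_mem _ (hc.mem w) (hmem w), ?_, fun i => ?_,
      fun i j hi hj => ?_⟩
    · rw [hc.symm, hsymm, smul_add]
    · rw [hc.nil, hzero [] (by simp), add_zero]
    · rw [hc.single, hzero [i] (by simp), add_zero]
    · rw [hzero [i, j], add_zero, hc.hook i j hi hj]
      rintro ⟨h3, -⟩
      simp only [totalDeg_cons, totalDeg_nil] at h3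
      push_cast at h3
      omega
  have hagree : ∀ w, totalDeg R.dg w ≠ -((s + 1 : ℕ) : ℤ) → c w + δ w = c w := by
    intro w hw
    rw [hzero w fun h => hw h.1, add_zero]
  refine ⟨_, hc', fun w hw => ?_, hagree⟩
  rcases lt_or_eq_of_le hw with hw' | hw'
  · rw [← h w (by push_cast at hw'; omega)]
    exact hc'.jacobiator_congr fun u hu => hagree u (by omega)
  -- unary structure constants were not changed, but there the Jacobiator is `D ∘ D`
  rcases Nat.lt_or_ge w.length 2 with hl | hl
  · rcases w with _ | ⟨i, _ | _⟩
    · simp only [totalDeg_nil] at hw'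
      push_cast at hw'
      omega
    · exact hc'.jacobiator_singleton _
    · simp at hl
  · rw [hc.jacobiator_sub hc' fun u hu => (hagree u (by omega)).symm, add_sub_cancel_left,
      hlift w ⟨hw'.symm, hl⟩, add_neg_cancel]

/-- There are structure constants for which all higher Jacobi identities hold. -/
theorem exists_jacobiator_eq_zero (R : GradedResolution O A V I)
    (hO : ∀ n : ℕ, n ≠ 0 → IsUnit (n : O)) :
    ∃ c, R.Admissible c ∧ ∀ L, R.jacobiator c L = 0 := by
  let S : ℕ → Type _ := fun s => {c : List I → V // R.Admissible c ∧
    ∀ w, -(s : ℤ) ≤ totalDeg R.dg w → R.jacobiator c (w.map R.base) = 0}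
  have step : ∀ s (c : S s), ∃ c' : S (s + 1),
      ∀ w, totalDeg R.dg w ≠ -((s + 1 : ℕ) : ℤ) → c'.1 w = c.1 w := by
    rintro s ⟨c, hc, h⟩
    obtain ⟨c', h1, h2, h3⟩ := hc.exists_step hO s h
    exact ⟨⟨c', h1, h2⟩, h3⟩
  choose next hnext using step
  obtain ⟨c₀, hc₀⟩ := exists_admissible (R := R) hO
  let f : ∀ s, S s := fun s => Nat.rec ⟨c₀, hc₀, fun w hw => hc₀.jacobiator_of_totalDeg _ (by
    rw [totalDeg_map_base]; push_cast at hw; omega)⟩ next s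
  let c : List I → V := fun w => (f (totalDeg R.dg w).natAbs).1 w
  have hnonpos : ∀ w, totalDeg R.dg w ≤ 0 := fun w => by
    have := totalDeg_word w (R := R)
    omega
  -- the structure constants of degree at least `-s` do not change after step `s`
  have hc : ∀ (s : ℕ) w, totalDeg R.dg w = -(s : ℤ) → (f s).1 w = c w := by
    intro s w hw
    obtain rfl : (totalDeg R.dg w).natAbs = s := by omega
    rfl
  have hstable : ∀ (s : ℕ) w, -(s : ℤ) ≤ totalDeg R.dg w → (f s).1 w = c w := by
    intro s w hw
    induction s with
    | zero => exact hc 0 w (le_antisymm (by simpa using hnonpos w) (by simpa using hw))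
    | succ s ih =>
      by_cases h : totalDeg R.dg w = -((s + 1 : ℕ) : ℤ)
      · exact hc _ w h
      · rw [← ih (by push_cast at hw h; omega)]
        exact hnext s (f s) w h
  have hadm : R.Admissible c := by
    refine ⟨fun p x y q => ?_, fun w => (f _).2.1.mem w, (f _).2.1.nil, fun i => (f _).2.1.single i,
      fun i j => (f _).2.1.hook i j⟩
    have h1 : totalDeg R.dg (p ++ x :: y :: q) = totalDeg R.dg (p ++ y :: x :: q) := by
      simp only [totalDeg_append, totalDeg_cons]
      ring
    have h2 := hnonpos (p ++ x :: y :: q)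
    rw [← hstable (totalDeg R.dg (p ++ x :: y :: q)).natAbs _ (by omega),
      ← hstable (totalDeg R.dg (p ++ x :: y :: q)).natAbs (p ++ y :: x :: q) (by omega)]
    exact (f _).2.1.symm p x y q
  refine ⟨c, hadm, fun L => hadm.jacobiator_eq_zero L fun w _ => ?_⟩
  have h1 := hnonpos w
  rw [← (f (totalDeg R.dg w).natAbs).2.2 w (by omega)]
  exact hadm.jacobiator_congr fun u hu =>
    (hstable (totalDeg R.dg w).natAbs u (by omega)).symm

end Existence

end GradedResolution

/-! ### Koszul signs, shuffles and unshuffle sums -/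

section Permutations

open Finset

/-- A product of a symmetric function over all pairs is invariant under permutations. -/
lemma prod_lt_comp_perm {M : Type*} [CommMonoid M] {k : ℕ} (h : Fin k → Fin k → M)
    (hs : ∀ a b, h a b = h b a) (τ : Equiv.Perm (Fin k)) :
    ∏ p : Fin k × Fin k with p.1 < p.2, h (τ p.1) (τ p.2) =
      ∏ p : Fin k × Fin k with p.1 < p.2, h p.1 p.2 := by
  let φ : Equiv.Perm (Fin k) → Fin k × Fin k → Fin k × Fin k := fun τ p =>
    if τ p.1 < τ p.2 then (τ p.1, τ p.2) else (τ p.2, τ p.1)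
  have hmem : ∀ (τ : Equiv.Perm (Fin k)) (p : Fin k × Fin k), p.1 < p.2 →
      (φ τ p).1 < (φ τ p).2 := by
    intro τ p hp
    simp only [φ]
    split_ifs with h1
    · exact h1
    · exact lt_of_le_of_ne (not_lt.1 h1) (τ.injective.ne hp.ne')
  have hinv : ∀ (τ τ' : Equiv.Perm (Fin k)) (_ : ∀ a, τ' (τ a) = a) (p : Fin k × Fin k),
      p.1 < p.2 → φ τ' (φ τ p) = p := by
    intro τ τ' ht p hp
    simp only [φ]
    split_ifs with h1 h2 h2
    all_goals simp_all [not_lt.2 hp.le]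
  refine prod_bij' (fun p _ => φ τ p) (fun p _ => φ τ⁻¹ p) ?_ ?_ ?_ ?_ ?_
  · intro p hp
    simpa using hmem τ p (by simpa using hp)
  · intro p hp
    simpa using hmem τ⁻¹ p (by simpa using hp)
  · intro p hp
    exact hinv τ τ⁻¹ (by simp) p (by simpa using hp)
  · intro p hp
    exact hinv τ⁻¹ τ (by simp) p (by simpa using hp)
  · intro p hp
    simp only [φ]
    split_ifs
    · rfl
    · exact hs _ _

/-- The Koszul sign as a product over pairs of positions, in a form that is symmetric in the two
members of a pair. -/
lemma koszulSign_eq {k : ℕ} (d : Fin k → ℤ) (σ : Equiv.Perm (Fin k)) :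
    koszulSign d σ = ∏ p : Fin k × Fin k with p.1 < p.2,
      if p.1 < p.2 ↔ σ p.1 < σ p.2 then 1 else Int.negOnePow (d (σ p.1) * d (σ p.2)) := by
  rw [koszulSign, ← filter_filter, prod_filter]
  refine prod_congr rfl fun p hp => ?_
  have hp' : p.1 < p.2 := by simpa using hp
  have hne : σ p.1 ≠ σ p.2 := σ.injective.ne hp'.ne
  by_cases h : σ p.2 < σ p.1
  · rw [if_pos h, if_neg (by simp [hp', h.le])]
  · rw [if_neg h, if_pos (by simp [hp', lt_of_le_of_ne (not_lt.1 h) hne])]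

/-- The cocycle identity of the Koszul sign. -/
lemma koszulSign_mul {k : ℕ} (d : Fin k → ℤ) (σ τ : Equiv.Perm (Fin k)) :
    koszulSign d (σ * τ) = koszulSign (fun i => d (σ i)) τ * koszulSign d σ := by
  rw [koszulSign_eq, koszulSign_eq, koszulSign_eq,
    ← prod_lt_comp_perm (fun a b => if a < b ↔ σ a < σ b then (1 : ℤˣ) else
      Int.negOnePow (d (σ a) * d (σ b))) _ τ, ← prod_mul_distrib]
  · refine prod_congr rfl fun p hp => ?_
    simp only [Equiv.Perm.mul_apply]
    by_cases h1 : p.1 < p.2 <;> by_cases h2 : τ p.1 < τ p.2 <;>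
      by_cases h3 : σ (τ p.1) < σ (τ p.2) <;> simp [h1, h2, h3, Int.units_mul_self]
  · intro a b
    by_cases hab : a = b
    · rw [hab]
    · have hne : σ a ≠ σ b := σ.injective.ne hab
      have h1 : (b < a) ↔ ¬ (a < b) :=
        ⟨fun h => h.not_gt, fun h => lt_of_le_of_ne (not_lt.1 h) (Ne.symm hab)⟩
      have h2 : (σ b < σ a) ↔ ¬ (σ a < σ b) :=
        ⟨fun h => h.not_gt, fun h => lt_of_le_of_ne (not_lt.1 h) hne.symm⟩
      refine if_congr ?_ rfl (by rw [mul_comm])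
      rw [h1, h2, not_iff_not]

lemma koszulSign_one {k : ℕ} (d : Fin k → ℤ) : koszulSign d 1 = 1 := by
  rw [koszulSign_eq]
  simp

lemma koszulSign_swap {n : ℕ} (d : Fin (n + 1) → ℤ) (i : Fin n) :
    koszulSign d (Equiv.swap i.castSucc i.succ) =
      Int.negOnePow (d i.castSucc * d i.succ) := by
  rw [koszulSign, show ({p : Fin (n + 1) × Fin (n + 1) | p.1 < p.2 ∧
      Equiv.swap i.castSucc i.succ p.2 < Equiv.swap i.castSucc i.succ p.1} : Finset _) =
      {(i.castSucc, i.succ)} from ?_, prod_singleton]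
  · simp [mul_comm]
  · ext ⟨a, b⟩
    simp only [mem_filter, mem_univ, true_and, mem_singleton, Prod.mk.injEq,
      Equiv.swap_apply_def, Fin.ext_iff, Fin.lt_def, Fin.val_castSucc, Fin.val_succ]
    split_ifs <;> (try simp only [Fin.val_castSucc, Fin.val_succ]) <;> omega

variable {X W : Type*} [AddCommGroup W] {dg : X → ℤ}

/-- A graded symmetric function is multiplied with the Koszul sign under any permutation of its
arguments. -/
lemma GradedSymm.perm {F : List X → W} (hF : GradedSymm dg F) {n : ℕ} (x : Fin (n + 1) → X)
    (σ : Equiv.Perm (Fin (n + 1))) :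
    F (List.ofFn fun i => x (σ i)) = koszulSign (fun i => dg (x i)) σ • F (List.ofFn x) := by
  have hσ : σ ∈ Submonoid.closure
      (Set.range fun i : Fin n => Equiv.swap i.castSucc i.succ) := by
    rw [Equiv.Perm.mclosure_swap_castSucc_succ]; trivial
  induction hσ using Submonoid.closure_induction generalizing x with
  | mem σ hσ =>
    obtain ⟨i, rfl⟩ := hσ
    have split : ∀ z : Fin (n + 1) → X, List.ofFn z = (List.ofFn z).take i ++
        z i.castSucc :: z i.succ :: (List.ofFn z).drop (i + 2) := by
      intro z
      have h1 : (i : ℕ) < (List.ofFn z).length := by simp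
      have h2 : (i : ℕ) + 1 < (List.ofFn z).length := by simp
      conv_lhs => rw [← List.take_append_drop i (List.ofFn z), List.drop_eq_getElem_cons h1,
        List.drop_eq_getElem_cons h2]
      simp only [List.getElem_ofFn]
      rfl
    have h1 : (List.ofFn fun j => x (Equiv.swap i.castSucc i.succ j)).take i =
        (List.ofFn x).take i := by
      refine List.ext_getElem (by simp) fun j hj _ => ?_
      simp only [List.length_take, lt_min_iff] at hj
      simp only [List.getElem_take, List.getElem_ofFn]
      rw [Equiv.swap_apply_of_ne_of_ne] <;> simp [Fin.ext_iff] <;> omega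
    have h2 : (List.ofFn fun j => x (Equiv.swap i.castSucc i.succ j)).drop (i + 2) =
        (List.ofFn x).drop (i + 2) := by
      refine List.ext_getElem (by simp) fun j hj _ => ?_
      simp only [List.getElem_drop, List.getElem_ofFn]
      rw [Equiv.swap_apply_of_ne_of_ne] <;> simp [Fin.ext_iff] <;> omega
    rw [split x, split fun j => x (Equiv.swap i.castSucc i.succ j), h1, h2, koszulSign_swap]
    simp only [Equiv.swap_apply_left, Equiv.swap_apply_right]
    rw [hF, mul_comm]
  | one => simp [koszulSign_one]
  | mul σ τ _ _ ih1 ih2 =>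
    have := ih2 fun i => x (σ i)
    simp only [Equiv.Perm.mul_apply]
    rw [this, ih1, koszulSign_mul, mul_smul]

lemma negOnePow_sum {ι : Type*} (s : Finset ι) (f : ι → ℤ) :
    (∑ i ∈ s, f i).negOnePow = ∏ i ∈ s, (f i).negOnePow := by
  classical
  induction s using Finset.induction_on with
  | empty => simp
  | insert a s ha ih => rw [sum_insert ha, prod_insert ha, Int.negOnePow_add, ih]

/-- The Koszul sign of moving the elements of the subset `S` of `T` in front of the other elements
of `T`. -/
def splitSign {ι : Type*} [LinearOrder ι] (d : ι → ℤ) (T S : Finset ι) : ℤˣ :=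
  ∏ a ∈ S, ∏ b ∈ T \ S with b < a, Int.negOnePow (d a * d b)

/-- An unshuffle sum as a sum over subsets. -/
lemma unshuffleSum_eq_sum_powerset {ι : Type*} [LinearOrder ι] (x : ι → X)
    (F : List X → List X → W) (L : List ι) (hL : L.Pairwise (· < ·)) :
    unshuffleSum dg (L.map x) F = ∑ S ∈ L.toFinset.powerset,
      splitSign (fun i => dg (x i)) L.toFinset S •
        F ((L.filter (· ∈ S)).map x) ((L.filter (· ∉ S)).map x) := by
  induction L generalizing F with
  | nil => simp [unshuffleSum, splitSign]
  | cons y L ih =>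
    rw [List.pairwise_cons] at hL
    have hy : y ∉ L.toFinset := fun h => lt_irrefl y (hL.1 y (by simpa using h))
    rw [List.map_cons, unshuffleSum, ih _ hL.2, ih _ hL.2, List.toFinset_cons,
      sum_powerset_insert hy, add_comm]
    congr 1
    · refine sum_congr rfl fun S hS => ?_
      rw [mem_powerset] at hS
      have hyS : y ∉ S := fun h => hy (hS h)
      have hfil : (L.filter (· ∈ S)).toFinset = S := by
        ext a
        simpa using fun h => by simpa using hS h
      have hnd : (L.filter (· ∈ S)).Nodup := (hL.2.imp fun h => ne_of_lt h).filter _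
      have hdeg : totalDeg dg ((L.filter (· ∈ S)).map x) = ∑ a ∈ S, dg (x a) := by
        conv_rhs => rw [← hfil, List.sum_toFinset _ hnd]
        simp [totalDeg, Function.comp_def]
      have hsign : splitSign (fun i => dg (x i)) (insert y L.toFinset) S =
          splitSign (fun i => dg (x i)) L.toFinset S *
            (dg (x y) * totalDeg dg ((L.filter (· ∈ S)).map x)).negOnePow := by
        rw [hdeg, mul_sum, negOnePow_sum, splitSign, splitSign, ← prod_mul_distrib]
        refine prod_congr rfl fun a ha => ?_
        have hya : y < a := hL.1 a (by simpa using hS ha)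
        rw [insert_sdiff_of_notMem _ hyS, filter_insert, if_pos hya, prod_insert (by simp [hy]),
          mul_comm, mul_comm (dg (x y))]
      rw [hsign, mul_smul]
      simp [hyS]
    · refine sum_congr rfl fun S hS => ?_
      rw [mem_powerset] at hS
      have hyS : y ∉ S := fun h => hy (hS h)
      have hne : ∀ a ∈ L, a ≠ y := fun a ha => (hL.1 a ha).ne'
      have hsign : splitSign (fun i => dg (x i)) (insert y L.toFinset) (insert y S) =
          splitSign (fun i => dg (x i)) L.toFinset S := by
        rw [splitSign, splitSign, insert_sdiff_insert, sdiff_insert_of_notMem hy,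
          prod_insert hyS, filter_eq_empty_iff.2, prod_empty, one_mul]
        intro b hb
        exact (hL.1 b (by simpa using (mem_sdiff.1 hb).1)).not_gt
      rw [hsign]
      have h1 : L.filter (· ∈ insert y S) = L.filter (· ∈ S) :=
        List.filter_congr fun a ha => by simp [hne a ha]
      have h2 : L.filter (· ∉ insert y S) = L.filter (· ∉ S) :=
        List.filter_congr fun a ha => by simp [hne a ha]
      rw [List.filter_cons_of_pos (by simp), List.filter_cons_of_neg (by simp), h1, h2,
        List.map_cons]

lemma ofFn_eq_filter_finRange {m N : ℕ} {f : Fin m → Fin N} (hf : StrictMono f)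
    {P : Fin N → Prop} [DecidablePred P] (hP : ∀ a, P a ↔ ∃ j, f j = a) :
    List.ofFn f = (List.finRange N).filter P := by
  refine List.Perm.eq_of_pairwise' (r := (· < ·)) ?_ ?_ ?_
  · exact List.pairwise_ofFn.2 fun i j hij => hf hij
  · exact (List.pairwise_lt_finRange N).filter _
  · refine (List.perm_ext_iff_of_nodup (List.nodup_ofFn.2 hf.injective)
      ((List.nodup_finRange N).filter _)).2 fun a => ?_
    simp [hP, List.mem_ofFn]

/-- The set of values of a permutation on the first `p` positions. -/
def frontSet {N : ℕ} (p : ℕ) (σ : Equiv.Perm (Fin N)) : Finset (Fin N) :=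
  {a | (σ.symm a).val < p}

lemma mem_frontSet {N p : ℕ} {σ : Equiv.Perm (Fin N)} {a : Fin N} :
    a ∈ frontSet p σ ↔ (σ.symm a).val < p := by
  simp [frontSet]

lemma mem_shuffles {N p : ℕ} {σ : Equiv.Perm (Fin N)} : σ ∈ shuffles N p ↔
    (∀ a b : Fin N, a < b → b.val < p → σ a < σ b) ∧
      ∀ a b : Fin N, a < b → p ≤ a.val → σ a < σ b := by
  simp [shuffles]

section Shuffle

variable {p q : ℕ} {σ : Equiv.Perm (Fin (p + q))}

lemma ofFn_front (hσ : σ ∈ shuffles (p + q) p) : (List.ofFn fun j => σ (Fin.castAdd q j)) =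
    (List.finRange (p + q)).filter (· ∈ frontSet p σ) := by
  refine ofFn_eq_filter_finRange (fun i j hij => (mem_shuffles.1 hσ).1
    (Fin.castAdd q i) (Fin.castAdd q j) hij j.isLt)
    fun a => ?_
  rw [mem_frontSet]
  constructor
  · intro h
    exact ⟨⟨_, h⟩, by simp [Fin.castAdd, Fin.castLE]⟩
  · rintro ⟨j, rfl⟩
    simp

lemma ofFn_back (hσ : σ ∈ shuffles (p + q) p) : (List.ofFn fun j => σ (Fin.natAdd p j)) =
    (List.finRange (p + q)).filter (· ∉ frontSet p σ) := by
  refine ofFn_eq_filter_finRange (fun i j hij => (mem_shuffles.1 hσ).2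
    (Fin.natAdd p i) (Fin.natAdd p j) (Nat.add_lt_add_left hij p) (Nat.le_add_right _ _))
    fun a => ?_
  rw [mem_frontSet, not_lt]
  constructor
  · intro h
    exact ⟨⟨(σ.symm a).val - p, by omega⟩, by
      rw [← Equiv.eq_symm_apply]
      ext
      simp
      omega⟩
  · rintro ⟨j, rfl⟩
    simp

lemma card_frontSet : (frontSet p σ).card = p := by
  have : frontSet p σ = univ.map ((Fin.castAddEmb q).trans σ.toEmbedding) := by
    ext a
    rw [mem_frontSet]
    simp only [mem_map, mem_univ, true_and]
    constructor
    · intro h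
      exact ⟨⟨_, h⟩, by simp [Fin.castAdd, Fin.castLE]⟩
    · rintro ⟨j, rfl⟩
      simp
  rw [this, card_map, card_univ, Fintype.card_fin]

/-- For a shuffle, the Koszul sign only involves the pairs of a front and a back position. -/
lemma koszulSign_shuffle (d : Fin (p + q) → ℤ) (hσ : σ ∈ shuffles (p + q) p) :
    koszulSign d σ = splitSign d univ (frontSet p σ) := by
  rw [koszulSign, splitSign, prod_sigma']
  refine prod_bij' (fun r _ => ⟨σ r.1, σ r.2⟩) (fun s _ => (σ.symm s.1, σ.symm s.2)) ?_ ?_ ?_ ?_ ?_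
  · rintro ⟨a, b⟩ h
    simp only [mem_filter, mem_univ, true_and] at h
    have h1 : ¬ b.val < p := fun hb => lt_asymm h.2 ((mem_shuffles.1 hσ).1 a b h.1 hb)
    have h2 : ¬ p ≤ a.val := fun ha => lt_asymm h.2 ((mem_shuffles.1 hσ).2 a b h.1 ha)
    simp only [mem_sigma, mem_filter, mem_sdiff, mem_univ, true_and, mem_frontSet,
      Equiv.symm_apply_apply]
    exact ⟨not_le.1 h2, h1, h.2⟩
  · rintro ⟨a, b⟩ h
    simp only [mem_sigma, mem_filter, mem_sdiff, mem_univ, true_and, mem_frontSet] at h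
    simp only [mem_filter, mem_univ, true_and, Equiv.apply_symm_apply]
    exact ⟨Fin.lt_def.2 (by omega), h.2.2⟩
  · intro r _; simp
  · intro s _; simp
  · intro r _; rfl

lemma frontSet_injOn :
    Set.InjOn (frontSet p) (shuffles (p + q) p : Set (Equiv.Perm (Fin (p + q)))) := by
  intro σ hσ τ hτ h
  have h1 := (ofFn_front hσ).trans (h ▸ (ofFn_front hτ).symm)
  have h2 := (ofFn_back hσ).trans (h ▸ (ofFn_back hτ).symm)
  ext a
  congr 1
  refine Fin.addCases (fun j => ?_) (fun j => ?_) a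
  · exact congrFun (List.ofFn_injective h1) j
  · exact congrFun (List.ofFn_injective h2) j

lemma exists_frontSet_eq (S : Finset (Fin (p + q))) (hS : S.card = p) :
    ∃ σ ∈ shuffles (p + q) p, frontSet p σ = S := by
  have hSc : Sᶜ.card = q := by rw [card_compl, Fintype.card_fin]; omega
  let σ : Equiv.Perm (Fin (p + q)) := finSumFinEquiv.symm.trans (finSumEquivOfFinset hS hSc)
  have h1 : ∀ j, σ (Fin.castAdd q j) = S.orderEmbOfFin hS j := fun j => by simp [σ]
  have h2 : ∀ j, σ (Fin.natAdd p j) = Sᶜ.orderEmbOfFin hSc j := fun j => by simp [σ]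
  refine ⟨σ, mem_shuffles.2 ⟨fun a b => ?_, fun a b => ?_⟩, ?_⟩
  · refine Fin.addCases (fun i => ?_) (fun i => ?_) a <;>
      refine Fin.addCases (fun j => ?_) (fun j => ?_) b <;> intro hab hb
    · rw [h1, h1, OrderEmbedding.lt_iff_lt]; exact hab
    · simp at hb
    · simp [Fin.lt_def] at hab; omega
    · simp at hb
  · refine Fin.addCases (fun i => ?_) (fun i => ?_) a <;>
      refine Fin.addCases (fun j => ?_) (fun j => ?_) b <;> intro hab hb
    · simp at hb; omega
    · simp at hb; omega
    · simp [Fin.lt_def] at hab; omega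
    · rw [h2, h2, OrderEmbedding.lt_iff_lt]; simpa using hab
  · refine eq_of_subset_of_card_le (fun a ha => ?_) (by rw [card_frontSet, hS])
    rw [mem_frontSet] at ha
    have : a = σ (Fin.castAdd q ⟨_, ha⟩) := by simp [Fin.castAdd, Fin.castLE]
    rw [this, h1]
    exact orderEmbOfFin_mem _ _ _

end Shuffle

/-- A shuffle is determined by the set of its front values, which is an arbitrary subset of the
right cardinality. -/
lemma sum_shuffles_eq_sum_powersetCard {N p q : ℕ} (h : p + q = N) (x : Fin N → X)
    (F : List X → List X → W) :
    ∑ σ ∈ shuffles N p, koszulSign (fun j => dg (x j)) σ •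
        F (List.ofFn fun j : Fin p => x (σ ⟨j.val, by omega⟩))
          (List.ofFn fun j : Fin q => x (σ ⟨p + j.val, by omega⟩)) =
      ∑ S ∈ powersetCard p univ, splitSign (fun i => dg (x i)) univ S •
        F (((List.finRange N).filter (· ∈ S)).map x)
          (((List.finRange N).filter (· ∉ S)).map x) := by
  subst h
  refine sum_bij (fun σ _ => frontSet p σ) (fun σ _ => ?_) (fun σ hσ τ hτ h => ?_) (fun S hS => ?_)
    (fun σ hσ => ?_)
  · rw [mem_powersetCard]
    exact ⟨subset_univ _, card_frontSet⟩
  · exact frontSet_injOn hσ hτ h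
  · obtain ⟨σ, hσ, h⟩ := exists_frontSet_eq S (mem_powersetCard.1 hS).2
    exact ⟨σ, hσ, h⟩
  · rw [koszulSign_shuffle _ hσ, ← ofFn_front hσ, ← ofFn_back hσ, List.map_ofFn, List.map_ofFn]
    rfl

/-- The sums over shuffles of the higher Jacobi identities are unshuffle sums. -/
lemma sum_shuffles_eq_unshuffleSum {n : ℕ} (x : Fin (n + 1) → X) (F : List X → List X → W)
    (hF : ∀ B, F [] B = 0) :
    ∑ i : Fin (n + 1), ∑ σ ∈ shuffles (n + 1) (i.val + 1), koszulSign (fun j => dg (x j)) σ •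
        F (List.ofFn fun j : Fin (i.val + 1) => x (σ ⟨j.val, by omega⟩))
          (List.ofFn fun j : Fin (n - i.val) => x (σ ⟨i.val + 1 + j.val, by omega⟩)) =
      unshuffleSum dg (List.ofFn x) F := by
  have huniv : (List.finRange (n + 1)).toFinset = univ := by ext; simp
  rw [List.ofFn_eq_map, unshuffleSum_eq_sum_powerset x F _ (List.pairwise_lt_finRange _), huniv,
    sum_powerset, card_univ, Fintype.card_fin, sum_range_succ', powersetCard_zero, sum_singleton]
  have h0 : (List.finRange (n + 1)).filter (· ∈ (∅ : Finset (Fin (n + 1)))) = [] := by simp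
  rw [h0, List.map_nil, hF, smul_zero, add_zero, sum_range]
  refine sum_congr rfl fun i _ => ?_
  exact sum_shuffles_eq_sum_powersetCard (by omega) x F

end Permutations

/-! ### The canonical free resolution of a module -/

section FreeResolution

/-- A module together with a submodule, the module of syzygies to be resolved next. -/
structure Syzygy (O : Type*) [CommRing O] where
  /-- the module -/
  M : Type*
  [grp : AddCommGroup M]
  [mod : Module O M]
  /-- the syzygies -/
  N : Submodule O M

attribute [instance] Syzygy.grp Syzygy.mod

/-- The free module on the elements of the module of syzygies, with the kernel of its canonical
map onto this module. -/
noncomputable def Syzygy.next {O : Type uO} [CommRing O] (s : Syzygy.{uO, max uO uA} O) :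
    Syzygy.{uO, max uO uA} O where
  M := s.N →₀ O
  N := LinearMap.ker (Finsupp.linearCombination O (Subtype.val : s.N → s.M))

/-- The modules and syzygies of the canonical free resolution of `A`, starting with the free module
on the elements of `A`. -/
noncomputable def syzygies (O : Type uO) (A : Type uA) [CommRing O] [AddCommGroup A] [Module O A] :
    ℕ → Syzygy.{uO, max uO uA} O
  | 0 => ⟨A →₀ O, LinearMap.ker (Finsupp.linearCombination O (id : A → A))⟩
  | n + 1 => (syzygies O A n).next

/-- Every module has a free resolution. -/
lemma exists_free_resolution (O : Type uO) (A : Type uA) [CommRing O] [AddCommGroup A]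
    [Module O A] :
    ∃ (E : ℕ → Type (max uO uA)) (_ : ∀ n, AddCommGroup (E n)) (_ : ∀ n, Module O (E n))
      (_ : ∀ n, Module.Free O (E n)) (d : ∀ n, E (n + 1) →ₗ[O] E n) (π : E 0 →ₗ[O] A),
      IsResolution d π := by
  let E : ℕ → Type (max uO uA) := fun n => (syzygies O A n).M
  let d : ∀ n, E (n + 1) →ₗ[O] E n := fun n =>
    Finsupp.linearCombination O (Subtype.val : (syzygies O A n).N → (syzygies O A n).M)
  let π : E 0 →ₗ[O] A := Finsupp.linearCombination O (id : A → A)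
  have hrange : ∀ n, LinearMap.range (d n) = (syzygies O A n).N := fun n => by
    refine (Finsupp.range_linearCombination O).trans ?_
    simp
  refine ⟨E, fun n => inferInstance, fun n => inferInstance, fun n => ?_, d, π, ?_, ?_,
    fun n => ?_⟩
  · cases n with
    | zero => exact inferInstanceAs (Module.Free O (A →₀ O))
    | succ n => exact inferInstanceAs (Module.Free O ((syzygies O A n).N →₀ O))
  · exact fun a =>
      ⟨Finsupp.single a 1, (Finsupp.linearCombination_single O 1 a).trans (one_smul O a)⟩
  · rw [LinearMap.exact_iff, hrange]
    rfl
  · rw [LinearMap.exact_iff, hrange]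
    rfl

end FreeResolution

/-! ### The direct sum of a free resolution as a graded resolution -/

section DirectSum

variable {O A : Type*} [CommRing O] [AddCommGroup A] [Module O A]
  {E : ℕ → Type*} [∀ n, AddCommGroup (E n)] [∀ n, Module O (E n)]
  {ι : ℕ → Type*} (b : ∀ n, Module.Basis (ι n) O (E n))

/-- The basis of the direct sum that is assembled from bases of the summands. -/
noncomputable def sumBasis : Module.Basis (Σ n, ι n) O (⨁ n, E n) := DFinsupp.basis b

lemma sumBasis_apply (i : Σ n, ι n) :
    sumBasis b i = DirectSum.of E i.1 (b i.1 i.2) := by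
  classical
  rw [sumBasis, Module.Basis.apply_eq_iff]
  change (DFinsupp.basis b).repr (DFinsupp.single i.1 (b i.1 i.2)) = _
  simp only [DFinsupp.basis, LinearEquiv.trans_apply, DFinsupp.mapRange.linearEquiv_apply,
    DFinsupp.mapRange_single, Module.Basis.repr_self]
  simp [Equiv.symm_apply_eq, sigmaFinsuppEquivDFinsupp_single]

/-- The span of the basis vectors of degree `d`: it is the summand `E n` if `d = deg n`, and zero
if `d` is not the degree of a summand. -/
abbrev sumPart (d : ℤ) : Submodule O (⨁ n, E n) :=
  Submodule.span O (sumBasis b '' {i | deg i.1 = d})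

lemma deg_injective : Function.Injective deg := fun m n h => by
  simp only [deg] at h
  omega

lemma of_mem_sumPart {n : ℕ} (x : E n) : DirectSum.of E n x ∈ sumPart b (deg n) := by
  have hx : x ∈ Submodule.span O (Set.range (b n)) := by rw [(b n).span_eq]; trivial
  have := Submodule.mem_map_of_mem (f := DirectSum.lof O ℕ E n) hx
  rw [Submodule.map_span] at this
  refine Submodule.span_mono ?_ this
  rintro _ ⟨_, ⟨i, rfl⟩, rfl⟩
  exact ⟨⟨n, i⟩, rfl, sumBasis_apply b ⟨n, i⟩⟩

lemma apply_eq_zero_of_mem_sumPart {d : ℤ} {v : ⨁ n, E n} (hv : v ∈ sumPart b d) {m : ℕ}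
    (hm : deg m ≠ d) : v m = 0 := by
  refine Submodule.span_induction (p := fun v _ => v m = 0) ?_ rfl ?_ ?_ hv
  · rintro _ ⟨i, hi, rfl⟩
    rw [sumBasis_apply]
    refine DirectSum.of_eq_of_ne _ _ _ ?_
    rintro rfl
    exact hm hi
  · intro u v _ _ hu hv
    rw [DirectSum.add_apply, hu, hv, add_zero]
  · intro f v _ hv
    rw [DirectSum.smul_apply, hv, smul_zero]

lemma eq_of_of_mem_sumPart {n : ℕ} {v : ⨁ n, E n} (hv : v ∈ sumPart b (deg n)) :
    v = DirectSum.of E n (v n) := by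
  refine DFinsupp.ext fun m => ?_
  by_cases h : m = n
  · subst h
    exact (DirectSum.of_eq_same _ _).symm
  · exact (apply_eq_zero_of_mem_sumPart b hv (deg_injective.ne h)).trans
      (DirectSum.of_eq_of_ne _ _ _ h).symm

/-- The differential of a complex as an endomorphism of the direct sum. -/
noncomputable def sumDiff (d : ∀ n, E (n + 1) →ₗ[O] E n) : (⨁ n, E n) →ₗ[O] ⨁ n, E n :=
  DirectSum.toModule O ℕ _ fun n => match n with
    | 0 => 0
    | n + 1 => DirectSum.lof O ℕ E n ∘ₗ d n

lemma sumDiff_zero (d : ∀ n, E (n + 1) →ₗ[O] E n) (x : E 0) :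
    sumDiff d (DirectSum.of E 0 x) = 0 :=
  DirectSum.toModule_lof O (M := E) 0 x

lemma sumDiff_succ (d : ∀ n, E (n + 1) →ₗ[O] E n) (n : ℕ) (x : E (n + 1)) :
    sumDiff d (DirectSum.of E (n + 1) x) = DirectSum.of E n (d n x) :=
  DirectSum.toModule_lof O (M := E) (n + 1) x

/-- A resolution by free modules with chosen bases as a graded resolution. -/
noncomputable def IsResolution.graded {d : ∀ n, E (n + 1) →ₗ[O] E n} {π : E 0 →ₗ[O] A}
    (h : IsResolution d π) : GradedResolution O A (⨁ n, E n) (Σ n, ι n) where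
  e := sumBasis b
  dg i := deg i.1
  dg_neg i := by simp only [deg]; omega
  D := sumDiff d
  D_mem_span := by
    rintro ⟨_ | n, i⟩
    · rw [sumBasis_apply, sumDiff_zero]
      exact Submodule.zero_mem _
    · rw [sumBasis_apply, sumDiff_succ]
      rw [show deg (n + 1) + 1 = deg n by simp [deg]]
      exact of_mem_sumPart b _
  D_D v := by
    induction v using DirectSum.induction_on with
    | zero => simp
    | of n x =>
      rcases n with _ | _ | n
      · rw [sumDiff_zero, map_zero]
      · rw [sumDiff_succ, sumDiff_zero]
      · rw [sumDiff_succ, sumDiff_succ, (h.exact_succ n).apply_apply_eq_zero, map_zero]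
    | add u v hu hv => rw [map_add, map_add, hu, hv, add_zero]
  π := π ∘ₗ DirectSum.component O ℕ E 0
  π_basis i hi := by
    have : sumBasis b i 0 = 0 :=
      apply_eq_zero_of_mem_sumPart b (Submodule.subset_span ⟨i, rfl, rfl⟩) (Ne.symm hi)
    rw [LinearMap.comp_apply, DirectSum.component, DFinsupp.lapply_apply]
    exact (congrArg π this).trans (map_zero π)
  π_D v := by
    induction v using DirectSum.induction_on with
    | zero => simp
    | of n x =>
      rcases n with _ | _ | n
      · rw [sumDiff_zero, map_zero]
      · rw [sumDiff_succ, LinearMap.comp_apply]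
        refine (congrArg π (DirectSum.of_eq_same _ _)).trans ?_
        exact h.exact_zero.apply_apply_eq_zero x
      · rw [sumDiff_succ, LinearMap.comp_apply]
        refine (congrArg π (DirectSum.of_eq_of_ne (n + 1) 0 (d (n + 1) x) (by simp))).trans
          (map_zero π)
    | add u v hu hv => rw [map_add, map_add, hu, hv, add_zero]
  exists_π_eq a := by
    obtain ⟨x, rfl⟩ := h.surjective a
    exact ⟨DirectSum.of E 0 x, of_mem_sumPart b x, congrArg π (DirectSum.of_eq_same 0 x)⟩
  exists_D_eq k hk v hv hD hπ := by
    obtain ⟨n, rfl⟩ : ∃ n : ℕ, k = deg n := ⟨(-k - 1).toNat, by simp only [deg]; omega⟩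
    obtain ⟨x, rfl⟩ : ∃ x, v = DirectSum.of E n x := ⟨_, eq_of_of_mem_sumPart b hv⟩
    obtain ⟨y, hy⟩ : ∃ y, d n y = x := by
      rcases n with _ | n
      · refine (h.exact_zero x).1 (Eq.trans ?_ hπ)
        exact congrArg π (DirectSum.of_eq_same _ _).symm
      · rw [sumDiff_succ] at hD
        exact (h.exact_succ n x).1 (DirectSum.of_injective n (hD.trans (map_zero _).symm))
    refine ⟨DirectSum.of E (n + 1) y, ?_, by rw [sumDiff_succ, hy]⟩
    rw [show deg n - 1 = deg (n + 1) by simp [deg]; ring]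
    exact of_mem_sumPart b y

end DirectSum

/-! ### The Lie ∞-algebroid of a free resolution -/

namespace GradedResolution

section FieldLinear

variable {K O A V I : Type*} [Field K] [CommRing O] [Algebra K O] [LieRing A] [LieAlgebra K A]
  [Module O A] [LieRingModule A O] [LieRinehartRing O A] [LieRinehartAlgebra K O A]
  [AddCommGroup V] [Module O V] [Module K V] [IsScalarTower K O V]
  {R : GradedResolution O A V I}

/-- The flat covariant derivatives are `K`-linear, the anchor acting by `K`-linear derivations. -/
lemma flat_smul_field (a : A) (r : K) (v : V) : R.flat a (r • v) = r • R.flat a v := by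
  have h : ⁅a, algebraMap K O r⁆ = 0 := (LieRinehartAlgebra.anchor K O A a).map_algebraMap r
  rw [← algebraMap_smul O r v, flat_smul, h, zero_smul, zero_add, algebraMap_smul]

lemma smul_field_flat (a : A) (r : K) (v : V) : R.flat (r • a) v = r • R.flat a v := by
  rw [← algebraMap_smul O r a, smul_flat, algebraMap_smul]

lemma derivPart_smul_field (p : List V) (r : K) (v : V) (q : List V) :
    R.derivPart (p ++ (r • v) :: q) = r • R.derivPart (p ++ v :: q) := by
  have hπ : R.π (r • v) = r • R.π v := LinearMap.map_smul_of_tower R.π r v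
  have hg : R.grading (r • v) = r • R.grading v := LinearMap.map_smul_of_tower R.grading r v
  rcases p with _ | ⟨a, _ | ⟨b, p⟩⟩
  · rcases q with _ | ⟨c, _ | _⟩
    · simp [derivPart]
    · simp [flat_smul_field, smul_field_flat, hπ, hg]
    · simp [derivPart]
  · rcases q with _ | _
    · simp [flat_smul_field, smul_field_flat, hπ]
    · simp [derivPart]
  · rw [derivPart_of_length, derivPart_of_length, smul_zero]
    all_goals simp

lemma bracket_smul_field {c : List I → V} (p : List V) (r : K) (v : V) (q : List V) :
    R.bracket c (p ++ (r • v) :: q) = r • R.bracket c (p ++ v :: q) := by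
  rw [bracket, derivPart_smul_field, ← algebraMap_smul O r v, multiExt_smul, algebraMap_smul,
    ← smul_add, ← bracket]

lemma ofFn_update {α : Type*} {k : ℕ} (x : Fin k → α) (i : Fin k) (u : α) :
    List.ofFn (Function.update x i u) =
      (List.ofFn x).take i ++ u :: (List.ofFn x).drop (i + 1) := by
  have h : List.ofFn (Function.update x i u) = (List.ofFn x).set i u := by
    refine List.ext_getElem (by simp) fun j hj _ => ?_
    simp only [List.getElem_ofFn, List.getElem_set, Function.update_apply, Fin.ext_iff]
    simp only [eq_comm]
  rw [h, List.set_eq_take_append_cons_drop, if_pos (by simp)]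

lemma ofFn_eq_take_append {α : Type*} {k : ℕ} (x : Fin k → α) (i : Fin k) :
    List.ofFn x = (List.ofFn x).take i ++ x i :: (List.ofFn x).drop (i + 1) := by
  conv_lhs => rw [← Function.update_eq_self i x]
  rw [ofFn_update]

/-- The brackets as multilinear maps over the ground field. -/
noncomputable def multilinearBracket (K : Type*) [Field K] [Algebra K O] [LieAlgebra K A]
    [LieRinehartAlgebra K O A] [Module K V] [IsScalarTower K O V] (R : GradedResolution O A V I)
    (c : List I → V) (k : ℕ) : MultilinearMap K (fun _ : Fin k => V) V :=
  MultilinearMap.mk' (fun x => R.bracket c (List.ofFn x))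
    (fun x i u v => by simp only [ofFn_update, bracket_add])
    (fun x i r v => by simp only [ofFn_update, bracket_smul_field])

@[simp] lemma multilinearBracket_apply (c : List I → V) (k : ℕ) (x : Fin k → V) :
    multilinearBracket K R c k x = R.bracket c (List.ofFn x) := rfl

end FieldLinear

end GradedResolution

open GradedResolution

section Structure

variable {K O A : Type*} [Field K] [CharZero K] [CommRing O] [Algebra K O]
  [LieRing A] [LieAlgebra K A] [Module O A] [LieRingModule A O]
  [LieRinehartRing O A] [LieRinehartAlgebra K O A]
  {E : ℕ → Type*} [∀ n, AddCommGroup (E n)] [∀ n, Module O (E n)]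
  [∀ n, Module K (E n)] [∀ n, IsScalarTower K O (E n)]

variable (K O A) in
/-- The anchor of a Lie-Rinehart algebra as an `O`-linear map. -/
noncomputable def anchorLinear : A →ₗ[O] Derivation K O O where
  toFun := LieRinehartAlgebra.anchor K O A
  map_add' := map_add (LieRinehartAlgebra.anchor K O A).toLieHom
  map_smul' f x := (LieRinehartAlgebra.anchor K O A).map_smul_apply f x

/-- A free resolution of a Lie-Rinehart algebra carries a Lie ∞-algebroid structure. -/
theorem IsResolution.exists_lieInftyAlgebroid (hfree : ∀ n, Module.Free O (E n))
    {d : ∀ n, E (n + 1) →ₗ[O] E n} {π : E 0 →ₗ[O] A} (h : IsResolution d π) :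
    ∃ L : LieInftyAlgebroid K O E,
      (∀ n (x : E (n + 1)),
        L.bracket 0 ![DirectSum.of E (n + 1) x] = DirectSum.of E n (d n x)) ∧
      L.TerminatesAt π := by
  let b := fun n => Module.Free.chooseBasis O (E n)
  let R := h.graded b
  have hO : ∀ n : ℕ, n ≠ 0 → IsUnit (n : O) := fun n hn => by
    have : IsUnit (n : K) := isUnit_iff_ne_zero.2 (Nat.cast_ne_zero.2 hn)
    simpa using this.map (algebraMap K O)
  obtain ⟨c, hc, hJ⟩ := R.exists_jacobiator_eq_zero hO
  have hπ : ∀ v : ⨁ n, E n, R.π v = π (v 0) := fun v => rfl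
  -- the summands consist of homogeneous elements
  let hom : ∀ n, E n → R.Homog := fun n x => ⟨deg n, DirectSum.of E n x, of_mem_sumPart b x⟩
  have hofFn : ∀ {k : ℕ} (m : Fin k → ℕ) (x : ∀ i, E (m i)),
      (List.ofFn fun i => DirectSum.of E (m i) (x i)) =
        (List.ofFn fun i => hom (m i) (x i)).map R.val := fun m x => by
    rw [List.map_ofFn]; rfl
  have hunary : ∀ n (x : E (n + 1)),
      R.bracket c [DirectSum.of E (n + 1) x] = DirectSum.of E n (d n x) := fun n x => by
    rw [hc.bracket_single]
    exact sumDiff_succ d n x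
  have hbinary : ∀ x y : E 0,
      ⁅π x, π y⁆ = π (R.bracket c [DirectSum.of E 0 x, DirectSum.of E 0 y] 0) := fun x y => by
    have : R.π (R.bracket c [DirectSum.of E 0 x, DirectSum.of E 0 y]) =
        ⁅R.π (DirectSum.of E 0 x), R.π (DirectSum.of E 0 y)⁆ := hc.π_bracket (hom 0 x) (hom 0 y)
    rw [hπ, hπ, hπ, DirectSum.of_eq_same, DirectSum.of_eq_same] at this
    exact this.symm
  let L : LieInftyAlgebroid K O E :=
    { projective := fun n => inferInstance
      bracket := fun k => multilinearBracket K R c (k + 1)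
      anchor := anchorLinear K O A ∘ₗ π
      bracket_symm := fun k m x σ => by
        have := hc.gradedSymm_bracket.perm (fun i => hom (m i) (x i)) σ
        simp only [multilinearBracket_apply, hofFn m x,
          hofFn (fun i => m (σ i)) fun i => x (σ i)]
        exact this
      bracket_degree := fun k m x l hl => by
        have := hc.bracket_mem (List.ofFn fun i => hom (m i) (x i))
        rw [multilinearBracket_apply, hofFn m x]
        refine apply_eq_zero_of_mem_sumPart b this ?_
        rw [totalDeg, List.map_ofFn, List.sum_ofFn]
        exact hl
      jacobi := fun n m x => by
        have := sum_shuffles_eq_unshuffleSum (dg := Sigma.fst) (fun i => hom (m i) (x i))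
          (fun A B => R.bracket c (R.hbracket c A :: B.map R.val)) fun B => by
            rw [hbracket, List.map_nil, hc.bracket_nil, bracket_zero_cons]
        refine Eq.trans ?_ (this.trans (hJ _))
        refine Finset.sum_congr rfl fun i _ => Finset.sum_congr rfl fun σ _ => ?_
        simp only [multilinearBracket_apply, List.ofFn_cons, hbracket, List.map_ofFn]
        rfl
      bracket_smul := fun k hk x i f => by
        rw [multilinearBracket_apply, multilinearBracket_apply, ofFn_update,
          R.bracket_smul, ← ofFn_eq_take_append x i]
        simp
        omega
      leibniz := fun x y f => by
        have := multiExt_smul (R := R) [x] f y [] c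
        simp only [List.cons_append, List.nil_append] at this
        change R.bracket c [x, f • y] = ⁅R.π x, f⁆ • y + f • R.bracket c [x, y]
        simp only [GradedResolution.bracket, derivPart_pair, this, flat_smul, map_smul, smul_flat,
          smul_add]
        abel
      anchor_unary := fun x => by
        change anchorLinear K O A (π (R.bracket c [DirectSum.of E 1 x] 0)) = 0
        rw [hunary, DirectSum.of_eq_same, h.exact_zero.apply_apply_eq_zero, map_zero]
      anchor_binary := fun x y => by
        change anchorLinear K O A (π (R.bracket c [DirectSum.of E 0 x, DirectSum.of E 0 y] 0)) =
          ⁅anchorLinear K O A (π x), anchorLinear K O A (π y)⁆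
        rw [← hbinary]
        exact (LieRinehartAlgebra.anchor K O A).toLieHom.map_lie _ _ }
  refine ⟨L, fun n x => ?_, fun x => rfl, fun x y => ?_⟩
  · exact hunary n x
  · exact hbinary x y

end Structure

end LieInfty

theorem mainTheorem1
    (K : Type uK) (O : Type uO) (A : Type uA)
    [Field K] [CharZero K] [CommRing O] [Algebra K O]
    [LieRing A] [LieAlgebra K A] [Module O A] [LieRingModule A O]
    [LieRinehartRing O A] [LieRinehartAlgebra K O A] :
    -- every free resolution of `A` carries a Lie ∞-algebroid structure
    (∀ (E : ℕ → Type uE) [∀ n, AddCommGroup (E n)] [∀ n, Module O (E n)]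
        [∀ n, Module K (E n)] [∀ n, IsScalarTower K O (E n)]
        (_ : ∀ n, Module.Free O (E n))
        (d : ∀ n, E (n + 1) →ₗ[O] E n) (π : E 0 →ₗ[O] A)
        (_ : LieInfty.IsResolution d π),
      ∃ L : LieInfty.LieInftyAlgebroid K O E,
        (∀ n (x : E (n + 1)),
          L.bracket 0 ![DirectSum.of E (n + 1) x] = DirectSum.of E n (d n x)) ∧
        L.TerminatesAt π) ∧
    -- `A` has a universal Lie ∞-algebroid
    (∃ (E : ℕ → Type (max uO uA)) (_ : ∀ n, AddCommGroup (E n)) (_ : ∀ n, Module O (E n))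
        (_ : ∀ n, Module K (E n)) (_ : ∀ n, IsScalarTower K O (E n))
        (L : LieInfty.LieInftyAlgebroid K O E) (π : E 0 →ₗ[O] A),
      L.IsUniversalFor π) := by
  refine ⟨fun E _ _ _ _ hfree d π h => h.exists_lieInftyAlgebroid hfree, ?_⟩
  obtain ⟨E, _, _, hfree, d, π, h⟩ := LieInfty.exists_free_resolution O A
  -- the `K`-module structures are obtained by restriction of scalars
  let _ : ∀ n, Module K (E n) := fun n => Module.compHom (E n) (algebraMap K O)
  have _ : ∀ n, IsScalarTower K O (E n) := fun n =>
    IsScalarTower.of_algebraMap_smul fun _ _ => rfl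
  obtain ⟨L, hL, hπ⟩ := h.exists_lieInftyAlgebroid (K := K) hfree
  have hd : L.unary = d := by
    funext n
    ext x
    exact (congrArg (fun v : DirectSum ℕ E => v n) (hL n x)).trans (DirectSum.of_eq_same n _)
  exact ⟨E, inferInstance, inferInstance, inferInstance, inferInstance, L, π, hπ, hd ▸ h⟩
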